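/- Here $\mathbb{N}=\{1,2,\dots\}$, an algorithm is a deterministic multitape Turing machine (given by a finite transition table), its steps are the steps of that machine, and inputs and outputs are written in binary. For $f:\mathbb{N}\to\mathbb{Z}$ put $m_f(n)=\log(1+n)+\log(2+|f(n)|)$. A \emph{PIO algorithm} for $f$ is an algorithm that, for some constants $c,d$ and every $n\in\mathbb{N}$, computes $f(n)$ from $n$ in at most $c\cdot m_f(n)^d$ steps; $f$ is a \emph{PIO function} if it has a PIO algorithm. For $A\subset\mathbb{N}$ let $p_A(n)$ be the number of partitions of $n$ with all parts in $A$. Corollary. Let $g:\mathbb{N}\to\mathbb{N}$ be strictly increasing, computable in at most $c(1+n)^e$ steps for some constants $c,e$ (that is, in a number of steps polynomial in the number $n$ itself), and polynomially bounded: $g(n)<(1+n)^D$ for every $n\in\mathbb{N}$ and some constant $D$. Let $A=\{g(1),g(2),\dots\}$ and $f(n)=p_A(n)$. 1. In formal power series, $$\sum_{n\ge0}f(n)q^n=\prod_{i\ge1}\Big(1+\sum_{j\ge1}q^{g(i)j}\Big)=\prod_{i\ge1}\frac{1}{1-q^{g(i)}},$$ and $f$, restricted to $\mathbb{N}$, is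 a PIO function. 2. A PIO algorithm for $f$ can be computed from an algorithm for $g$ together with $d=\gcd(A)$ and a finite set $B\subset A$ with $\gcd(B)=d$. That is, there is one computable map $\Phi$, not depending on $g$, taking a Turing machine, a natural number and a finite list of natural numbers to a Turing machine, such that for every $g$ as above, every machine $M$ computing $g$ in a number of steps polynomial in $n$, for $d=\gcd(A)$ and for every finite list $B$ of elements of $A$ with $\gcd(B)=d$, the machine $\Phi(M,d,B)$ is a PIO algorithm for $f$. 3. For example, the number of partitions of $n$ into squares, $p_{\{k^2:\,k\in\mathbb{N}\}}(n)$, is a PIO function. -/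

import Mathlib

open scoped PowerSeries PowerSeries.WithPiTopology

/-! ### Multitape Turing machines as finite tables

Tape symbols and states are natural numbers; only the finitely many that occur in the input
alphabet or in the table are ever used.  Symbol `0` is the blank. -/

/-- What one rule says about one tape: the symbol that has to be under the head (`none`: any
symbol), the symbol to be written (`none`: leave the cell as it is), and the subsequent head move
(`some false`: one cell to the left, `some true`: one cell to the right, `none`: stay). -/
abbrev TapeAction : Type := Option ℕ × Option ℕ × Option Bool

/-- A rule `(q, as, q')`: in state `q`, if for each `i` the `i`-th head sees a symbol admitted by
`as[i]`, carry out all the actions `as[i]` simultaneously and go to state `q'`.  Tapes with index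
`≥ as.length` are neither inspected nor changed. -/
abbrev TMRule : Type := ℕ × List TapeAction × ℕ

/-- A deterministic multitape Turing machine, given by its finite transition table: the first rule
of the list that applies is executed, and the machine halts when no rule applies.  The start state
is `0`.  A rule with a `none` in its reading part abbreviates the rules for all the symbols.  The
number of tapes of the machine is the largest length of a list of actions in the table (tape `0`,
the input/output tape, being always present). -/
abbrev TM : Type := List TMRule

/-- The action that a rule prescribes for tape `i`. -/
def TMRule.action (r : TMRule) (i : ℕ) : TapeAction := r.2.1.getD i (none, none, none)

/-- A configuration: the state, and the contents and head positions of the two-way infinite tapes.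
For uniformity the tapes are indexed by `ℕ`; those that do not belong to the machine stay blank. -/
structure TMConfig where
  state : ℕ
  tape : ℕ → Turing.Tape ℕ

/-- The rule `r` applies in the configuration `c`. -/
def TMRule.Applies (r : TMRule) (c : TMConfig) : Prop :=
  r.1 = c.state ∧
    ∀ i < r.2.1.length, ∀ s : ℕ, (r.action i).1 = some s → (c.tape i).head = s

instance (r : TMRule) (c : TMConfig) : Decidable (r.Applies c) := by
  have (i : ℕ) : Decidable (∀ s : ℕ, (r.action i).1 = some s → (c.tape i).head = s) :=
    match h : (r.action i).1 with
    | none => isTrue (by simp)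
    | some s => decidable_of_iff ((c.tape i).head = s) (by simp)
  unfold TMRule.Applies
  infer_instance

/-- The effect of an action on a tape: write, then move. -/
def TapeAction.perform (a : TapeAction) (T : Turing.Tape ℕ) : Turing.Tape ℕ :=
  let T' := match a.2.1 with
    | none => T
    | some s => T.write s
  match a.2.2 with
  | none => T'
  | some false => T'.move Turing.Dir.left
  | some true => T'.move Turing.Dir.right

/-- One step of the machine `M`; the value is `none` when `M` halts in the configuration `c`. -/
def TM.step (M : TM) (c : TMConfig) : Option TMConfig :=
  (M.find? fun r => decide (r.Applies c)).map fun r =>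
    ⟨r.2.2, fun i => TapeAction.perform (r.action i) (c.tape i)⟩

/-- `M` gets from `c` to `c'` in exactly `t` steps. -/
def TM.StepsTo (M : TM) : ℕ → TMConfig → TMConfig → Prop
  | 0, c, c' => c = c'
  | t + 1, c, c' => ∃ c₁, M.step c = some c₁ ∧ TM.StepsTo M t c₁ c'

/-- The configuration in state `q` with the word `w` on tape `0`, the head on its first symbol,
and with all other cells of all tapes blank. -/
def TMConfig.ofWord (q : ℕ) (w : List ℕ) : TMConfig :=
  ⟨q, fun i => if i = 0 then Turing.Tape.mk₁ w else default⟩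

/-- Started on the input word `u`, the machine `M` halts after exactly `t` steps with output `v`.
Input and output stand on tape `0`; the work tapes are blank at the start and at the end. -/
def TM.Computes (M : TM) (u v : List ℕ) (t : ℕ) : Prop :=
  ∃ q : ℕ, M.StepsTo t (TMConfig.ofWord 0 u) (TMConfig.ofWord q v) ∧
    M.step (TMConfig.ofWord q v) = none

/-! ### Binary notation -/

/-- The binary notation of `n`, least significant digit first; the digits `0` and `1` are
represented by the tape symbols `1` and `2`.  (The number `0` is the empty word.) -/
def binaryNat (n : ℕ) : List ℕ := n.bits.map fun b => if b then 2 else 1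

/-- The binary notation of an integer; the minus sign is represented by the tape symbol `3`. -/
def binaryInt (z : ℤ) : List ℕ :=
  if z < 0 then 3 :: binaryNat z.natAbs else binaryNat z.natAbs

/-! ### PIO functions and functions computable in `poly(n)` steps -/

/-- `m_f(n) = log (1 + n) + log (2 + |f n|)`. -/
noncomputable def pioSize (f : ℕ+ → ℤ) (n : ℕ+) : ℝ :=
  Real.log (1 + ((n : ℕ) : ℝ)) + Real.log (2 + |(f n : ℝ)|)

/-- `M` is a PIO algorithm for `f`: for some constants `c`, `d` it computes `f n` from `n`, both in
binary, in at most `c * m_f(n) ^ d` steps, for every `n ≥ 1`. -/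
def IsPIOAlgorithm (M : TM) (f : ℕ+ → ℤ) : Prop :=
  ∃ c d : ℕ, ∀ n : ℕ+, ∃ t : ℕ,
    M.Computes (binaryNat n) (binaryInt (f n)) t ∧ (t : ℝ) ≤ c * pioSize f n ^ d

/-- `f` is a PIO function (polynomial in input and output). -/
def IsPIO (f : ℕ+ → ℤ) : Prop := ∃ M : TM, IsPIOAlgorithm M f

/-- `M` computes `g n` from `n`, both in binary, in `poly(n)` steps (polynomially many in the number
`n` itself, not in the length of its binary notation). -/
def ComputesInPolySteps (M : TM) (g : ℕ+ → ℕ+) : Prop :=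
  ∃ c e : ℕ, ∀ n : ℕ+, ∃ t : ℕ,
    M.Computes (binaryNat n) (binaryNat (g n)) t ∧ t ≤ c * (1 + (n : ℕ)) ^ e

/-! ### Restricted partitions -/

open Classical in
/-- The number `p_A(n)` of partitions of `n` all of whose parts lie in `A`. -/
noncomputable def numPartitions (A : Set ℕ) (n : ℕ) : ℕ :=
  (Nat.Partition.restricted n (fun i => i ∈ A)).card

/-- The set `{g(1), g(2), …}`. -/
def valueSet (g : ℕ+ → ℕ+) : Set ℕ := Set.range fun n => (g n : ℕ)

/-- `d` is the greatest common divisor of the (possibly infinite) set `A`. -/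
def IsGcdOf (d : ℕ) (A : Set ℕ) : Prop := ∀ e : ℕ, e ∣ d ↔ ∀ a ∈ A, e ∣ a

/-! The coefficient of `q ^ n` in the product involves only the factors with `g i ≤ n`. As `g` is
strictly increasing, `g i ≥ i`, so the factors with `i ≤ n` suffice, and each geometric series may
be cut after the exponent `g i * n`. There remains a polynomial `P` over `ℕ` with `P(1) = (n + 1) ^
n < 2 ^ W`, where `W = n * (n + 1)`. All coefficients of `P` are therefore digits in base `2 ^ W`,
and `p_A(n)` is digit number `n` of the integer `P(2 ^ W)` (Kronecker substitution,
`digit_geomProd`). This integer has polynomially many bits in `n` and is built by shifts and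
additions, so `p_A(n)` takes `poly(n)` steps (`does_countMachine`).

Such a time is admissible only where the output is long. Let `d = gcd(A)`. If `d ∤ n`, the answer is
`0` and must be found in time polynomial in `log n`: the residue modulo `d` is computed digit by
digit, in time linear in the length of the input. If `d ∣ n`, the number of partitions is large
(`exists_two_pow_le_numPartitions`). There is a finite `t ⊆ A` whose `ℕ`-combinations are all large
multiples of `d`. Each set `S` of elements outside `t` among the first `k` elements of `A` is
completed by parts from `t` to a partition of `n`, and `S` can be read off from that partition.
Since `g` is polynomially bounded, `k` of order `n ^ (1 / (D + 1))` is possible, whence `p_A(n) ≥ 2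
^ (k - |t|)`. So `n` is bounded by a polynomial in `m_f(n)` (`one_add_le_pioSize_pow`), and
`poly(n)` steps are `poly(m_f(n))` steps.

For the implementation, a tape with its head on the first symbol is a stack. Machines are composed
by `seq`, `ite` and `loop`, and `Does` records the effect on the stacks with a time bound. The
machine for `g` runs on the tapes from number 12 on. The whole table arises from `M` and `d` by
primitive recursive list operations. -/

/-! ### Combining Turing machines -/

namespace TM

/-- Started in state `0` on the tapes `T`, the machine halts after exactly `t` steps with the
tapes `T'`. -/
def Run (M : TM) (T T' : ℕ → Turing.Tape ℕ) (t : ℕ) : Prop :=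
  ∃ q, M.StepsTo t ⟨0, T⟩ ⟨q, T'⟩ ∧ M.step ⟨q, T'⟩ = none

/-- Rename the states of a machine. -/
def mapStates (f : ℕ → ℕ) (M : TM) : TM := M.map fun r => (f r.1, r.2.1, f r.2.2)

/-- Unconditional rules leading to `x` from every state in which a run of `M` can end, the states
being renamed by `f`. -/
def exits (f : ℕ → ℕ) (x : ℕ) (M : TM) : TM := (f 0, [], x) :: M.map fun r => (f r.2.2, [], x)

/-! ### Steps of a machine assembled from pieces -/

theorem stepsTo_trans {M : TM} {t t' : ℕ} {c c' c'' : TMConfig} (h : M.StepsTo t c c')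
    (h' : M.StepsTo t' c' c'') : M.StepsTo (t + t') c c'' := by
  induction t generalizing c with
  | zero => cases h; simpa using h'
  | succ t ih =>
    obtain ⟨c₁, h₁, h₂⟩ := h
    rw [Nat.add_right_comm]
    exact ⟨c₁, h₁, ih h₂⟩

theorem stepsTo_one {M : TM} {c c' : TMConfig} (h : M.step c = some c') : M.StepsTo 1 c c' :=
  ⟨c', h, rfl⟩

theorem step_append (A B : TM) (c : TMConfig) :
    TM.step (A ++ B) c = (A.step c).or (B.step c) := by
  unfold TM.step
  rw [List.find?_append]
  cases List.find? (fun r : TMRule => decide (r.Applies c)) A <;> simp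

theorem step_eq_none_of_state {A : TM} {c : TMConfig} (h : ∀ r ∈ A, r.1 ≠ c.state) :
    A.step c = none := by
  unfold TM.step
  simp only [Option.map_eq_none_iff, List.find?_eq_none, decide_eq_true_eq]
  exact fun r hr h' => h r hr h'.1

theorem step_cons (r : TMRule) (A : TM) (c : TMConfig) :
    TM.step (r :: A) c = if r.Applies c then
      some ⟨r.2.2, fun i => TapeAction.perform (r.action i) (c.tape i)⟩ else A.step c := by
  unfold TM.step
  rw [List.find?_cons]
  split_ifs with h <;> simp [h]

theorem perform_none (T : Turing.Tape ℕ) : TapeAction.perform (none, none, none) T = T := rfl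

theorem applies_nil (q x : ℕ) (c : TMConfig) : TMRule.Applies (q, [], x) c ↔ q = c.state := by
  simp [TMRule.Applies]

theorem action_nil (q x i : ℕ) : TMRule.action (q, [], x) i = (none, none, none) := by
  simp [TMRule.action]

theorem step_mapStates {f : ℕ → ℕ} (hf : f.Injective) (M : TM) (q : ℕ) (T : ℕ → Turing.Tape ℕ) :
    (M.mapStates f).step ⟨f q, T⟩ = (M.step ⟨q, T⟩).map fun c => ⟨f c.state, c.tape⟩ := by
  induction M with
  | nil => rfl
  | cons r M ih =>
    have e : mapStates f (r :: M) = (f r.1, r.2.1, f r.2.2) :: mapStates f M := rfl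
    have h : TMRule.Applies (f r.1, r.2.1, f r.2.2) ⟨f q, T⟩ ↔ r.Applies ⟨q, T⟩ := by
      simp only [TMRule.Applies, hf.eq_iff]
      rfl
    rw [e, step_cons, step_cons, ih]
    simp only [h]
    split_ifs <;> rfl

/-- All rules of `exits` carry the same action and target, so it does not matter which of several
rules for the same state comes first. -/
theorem step_exits {f : ℕ → ℕ} {x : ℕ} {M : TM} {q : ℕ} (hq : q = 0 ∨ ∃ r ∈ M, r.2.2 = q)
    (T : ℕ → Turing.Tape ℕ) : (M.exits f x).step ⟨f q, T⟩ = some ⟨x, T⟩ := by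
  have key : ∀ L : TM, (∀ r ∈ L, r.2 = ([], x)) → (∃ r ∈ L, r.1 = f q) →
      L.step ⟨f q, T⟩ = some ⟨x, T⟩ := by
    intro L h1 h2
    induction L with
    | nil => simp at h2
    | cons r L ih =>
      obtain ⟨a, b⟩ := r
      obtain rfl : b = ([], x) := h1 _ List.mem_cons_self
      rw [step_cons]
      simp only [applies_nil]
      split_ifs with h
      · simp [action_nil, perform_none]
      · refine ih (fun r hr => h1 r (List.mem_cons_of_mem _ hr)) ?_
        obtain ⟨r, hr, h'⟩ := h2
        rcases List.mem_cons.1 hr with rfl | hr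
        · exact absurd h' h
        · exact ⟨r, hr, h'⟩
  apply key
  · intro r hr
    rcases List.mem_cons.1 hr with rfl | hr
    · rfl
    · obtain ⟨r, _, rfl⟩ := List.mem_map.1 hr
      rfl
  · rcases hq with rfl | ⟨r, hr, rfl⟩
    · exact ⟨_, List.mem_cons_self, rfl⟩
    · exact ⟨_, List.mem_cons_of_mem _ (List.mem_map.2 ⟨r, hr, rfl⟩), rfl⟩

/-- The halting state of a run is not known in advance; this confines it to a finite list readable
from the table, exactly the states covered by `exits`. -/
theorem eq_zero_or_target {M : TM} {t q : ℕ} {T T' : ℕ → Turing.Tape ℕ} {q₀ : ℕ}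
    (h : M.StepsTo t ⟨q₀, T⟩ ⟨q, T'⟩) (h₀ : q₀ = 0 ∨ ∃ r ∈ M, r.2.2 = q₀) :
    q = 0 ∨ ∃ r ∈ M, r.2.2 = q := by
  induction t generalizing q₀ T with
  | zero => cases h; exact h₀
  | succ t ih =>
    obtain ⟨c, h1, h2⟩ := h
    refine ih (q₀ := c.state) (T := c.tape) h2 (Or.inr ?_)
    simp only [TM.step, Option.map_eq_some_iff] at h1
    obtain ⟨r, hr, rfl⟩ := h1
    exact ⟨r, List.mem_of_find?_eq_some hr, rfl⟩

/-- If `N` contains `M` with states renamed by `f`, a computation of `M` is one of `N`. -/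
theorem stepsTo_embed {f : ℕ → ℕ} (hf : f.Injective) {M A B : TM}
    (hA : ∀ r ∈ A, ∀ q, r.1 ≠ f q) {t q q' : ℕ} {T T' : ℕ → Turing.Tape ℕ}
    (h : M.StepsTo t ⟨q, T⟩ ⟨q', T'⟩) :
    TM.StepsTo (A ++ (M.mapStates f ++ B)) t ⟨f q, T⟩ ⟨f q', T'⟩ := by
  induction t generalizing q T with
  | zero => cases h; rfl
  | succ t ih =>
    obtain ⟨c, h1, h2⟩ := h
    refine ⟨⟨f c.state, c.tape⟩, ?_, ih h2⟩
    rw [step_append, step_eq_none_of_state (fun r hr => hA r hr q), step_append,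
      step_mapStates hf, h1]
    rfl

/-- The exit rules stand after the rules of `M`, so they fire only once `M` has halted, at the price
of one more step. -/
theorem run_embed_exits {f : ℕ → ℕ} (hf : f.Injective) {M A B : TM} {x : ℕ}
    (hA : ∀ r ∈ A, ∀ q, r.1 ≠ f q) {t : ℕ} {T T' : ℕ → Turing.Tape ℕ} (h : M.Run T T' t) :
    TM.StepsTo (A ++ (M.mapStates f ++ (M.exits f x ++ B))) (t + 1) ⟨f 0, T⟩ ⟨x, T'⟩ := by
  obtain ⟨q, h1, h2⟩ := h
  refine stepsTo_trans (stepsTo_embed hf hA h1) (stepsTo_one ?_)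
  rw [step_append, step_eq_none_of_state (fun r hr => hA r hr q), step_append,
    step_mapStates hf, h2, step_append, step_exits (eq_zero_or_target h1 (Or.inl rfl))]
  rfl

theorem run_embed {f : ℕ → ℕ} (hf : f.Injective) {M A B : TM}
    (hA : ∀ r ∈ A, ∀ q, r.1 ≠ f q) (hB : ∀ r ∈ B, ∀ q, r.1 ≠ f q) {t : ℕ}
    {T T' : ℕ → Turing.Tape ℕ} (h : M.Run T T' t) :
    ∃ q, TM.StepsTo (A ++ (M.mapStates f ++ B)) t ⟨f 0, T⟩ ⟨q, T'⟩ ∧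
      TM.step (A ++ (M.mapStates f ++ B)) ⟨q, T'⟩ = none := by
  obtain ⟨q, h1, h2⟩ := h
  refine ⟨f q, stepsTo_embed hf hA h1, ?_⟩
  rw [step_append, step_eq_none_of_state (fun r hr => hA r hr q), step_append,
    step_mapStates hf, h2, step_eq_none_of_state (fun r hr => hB r hr q)]
  rfl

/-- First `A`, then `B`. -/
def seq (A B : TM) : TM :=
  A.mapStates (fun q => 2 * q) ++ (A.exits (fun q => 2 * q) 1 ++ B.mapStates (fun q => 2 * q + 1))

/-- The reading part of a rule: head `i` sees the symbol `s`. -/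
def test (i s : ℕ) : List TapeAction :=
  List.replicate i (none, none, none) ++ [(some s, none, none)]

/-- If head `i` sees `s` then `A`, else `B`. -/
def ite (i s : ℕ) (A B : TM) : TM :=
  (0, test i s, 1) :: (0, [], 2) ::
    (A.mapStates (fun q => 2 * q + 1) ++ B.mapStates (fun q => 2 * q + 2))

/-- Repeat `A` until head `i` sees `s`. -/
def loop (i s : ℕ) (A : TM) : TM :=
  (0, test i s, 2) :: (0, [], 1) ::
    (A.mapStates (fun q => 2 * q + 1) ++ A.exits (fun q => 2 * q + 1) 0)

/-- Carry out one action, on tape `i`. -/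
def act (i : ℕ) (w : Option ℕ) (m : Option Bool) : TM :=
  [(0, List.replicate i (none, none, none) ++ [(none, w, m)], 1)]

/-- Use the tapes from number `s` on. -/
def shift (s : ℕ) (M : TM) : TM :=
  M.map fun r => (r.1, List.replicate s (none, none, none) ++ r.2.1, r.2.2)

/-- Replace the symbol under head `i` according to a table. -/
def relabel (i : ℕ) (l : List (ℕ × ℕ)) : TM :=
  l.map fun p => (0, List.replicate i (none, none, none) ++ [(some p.1, some p.2, none)], 1)

/-! ### Runs of the combined machines -/

theorem getD_replicate_append (i j : ℕ) (a : TapeAction) :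
    (List.replicate i ((none, none, none) : TapeAction) ++ [a]).getD j (none, none, none)
      = if j = i then a else (none, none, none) := by
  rcases lt_trichotomy j i with h | rfl | h
  · rw [List.getD_append _ _ _ _ (by simpa using h), if_neg h.ne]
    simp [h]
  · simp
  · rw [if_neg h.ne', List.getD_eq_default]
    simp; omega

theorem applies_single {i q x : ℕ} {a : TapeAction} {c : TMConfig} :
    TMRule.Applies (q, List.replicate i (none, none, none) ++ [a], x) c ↔
      q = c.state ∧ ∀ s, a.1 = some s → (c.tape i).head = s := by
  simp only [TMRule.Applies, TMRule.action, getD_replicate_append]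
  refine and_congr_right fun _ => ⟨fun h => ?_, fun h j _ s => ?_⟩
  · simpa using h i (by simp)
  · split_ifs with hj
    · subst hj; exact h s
    · simp

theorem step_single {i q x : ℕ} {a : TapeAction} {c : TMConfig} {A : TM} :
    TM.step ((q, List.replicate i (none, none, none) ++ [a], x) :: A) c =
      if q = c.state ∧ ∀ s, a.1 = some s → (c.tape i).head = s then
        some ⟨x, Function.update c.tape i (a.perform (c.tape i))⟩ else A.step c := by
  rw [step_cons]
  simp only [applies_single]
  split_ifs with h
  · congr 2
    funext j
    simp only [TMRule.action, getD_replicate_append, Function.update_apply]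
    split_ifs with hj
    · rw [hj]
    · rfl
  · rfl

theorem step_test {i s q x : ℕ} {c : TMConfig} {A : TM} :
    TM.step ((q, test i s, x) :: A) c =
      if q = c.state ∧ (c.tape i).head = s then some ⟨x, c.tape⟩ else A.step c := by
  rw [test, step_single]
  simp only [Option.some.injEq, forall_eq']
  congr
  exact Function.update_eq_self i c.tape

theorem step_goto {q x : ℕ} {c : TMConfig} {A : TM} :
    TM.step ((q, [], x) :: A) c = if q = c.state then some ⟨x, c.tape⟩ else A.step c := by
  rw [step_cons]
  simp only [applies_nil, action_nil, perform_none]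

theorem ne_of_mem_mapStates {f : ℕ → ℕ} {M : TM} {p : ℕ} (h : ∀ q, f q ≠ p) :
    ∀ r ∈ M.mapStates f, r.1 ≠ p := by
  intro r hr
  obtain ⟨r, _, rfl⟩ := List.mem_map.1 hr
  exact h _

theorem ne_of_mem_exits {f : ℕ → ℕ} {M : TM} {p x : ℕ} (h : ∀ q, f q ≠ p) :
    ∀ r ∈ M.exits f x, r.1 ≠ p := by
  intro r hr
  rcases List.mem_cons.1 hr with rfl | hr
  · exact h _
  · obtain ⟨r, _, rfl⟩ := List.mem_map.1 hr
    exact h _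

variable {A B : TM} {T T' T'' : ℕ → Turing.Tape ℕ} {t t' i s : ℕ}

theorem Run.seq (hA : A.Run T T' t) (hB : B.Run T' T'' t') : (A.seq B).Run T T'' (t + 1 + t') := by
  have h1 := run_embed_exits (f := fun q => 2 * q) (fun a b h => by simpa using h) (A := [])
    (B := B.mapStates (fun q => 2 * q + 1)) (x := 1) (by simp) hA
  obtain ⟨q, h2, h3⟩ := run_embed (f := fun q => 2 * q + 1) (fun a b h => by simpa using h)
    (A := A.mapStates (fun q => 2 * q) ++ A.exits (fun q => 2 * q) 1) (B := []) (by
      intro r hr q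
      rcases List.mem_append.1 hr with hr | hr
      · exact ne_of_mem_mapStates (fun q' => by omega) r hr
      · exact ne_of_mem_exits (fun q' => by omega) r hr) (by simp) hB
  refine ⟨q, stepsTo_trans h1 ?_, ?_⟩
  · simpa [TM.seq] using h2
  · simpa [TM.seq] using h3

theorem Run.ite_pos (hA : A.Run T T' t) (h : (T i).head = s) :
    (TM.ite i s A B).Run T T' (1 + t) := by
  obtain ⟨q, h2, h3⟩ := run_embed (f := fun q => 2 * q + 1) (fun a b h => by simpa using h)
    (A := [(0, test i s, 1), (0, [], 2)]) (B := B.mapStates (fun q => 2 * q + 2)) (by simp)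
    (fun r hr q => ne_of_mem_mapStates (fun q' => by omega) r hr) hA
  refine ⟨q, stepsTo_trans (stepsTo_one ?_) h2, h3⟩
  rw [ite, step_test, if_pos ⟨rfl, h⟩]

theorem Run.ite_neg (hB : B.Run T T' t) (h : (T i).head ≠ s) :
    (TM.ite i s A B).Run T T' (1 + t) := by
  obtain ⟨q, h2, h3⟩ := run_embed (f := fun q => 2 * q + 2) (fun a b h => by simpa using h)
    (A := (0, test i s, 1) :: (0, [], 2) :: A.mapStates (fun q => 2 * q + 1)) (B := []) (by
      intro r hr q
      simp only [List.mem_cons] at hr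
      rcases hr with rfl | rfl | hr
      · simp
      · simp
      · exact ne_of_mem_mapStates (fun q' => by omega) r hr) (by simp) hB
  refine ⟨q, stepsTo_trans (stepsTo_one ?_) (c' := ⟨2 * 0 + 2, T⟩) ?_, ?_⟩
  · rw [ite, step_test, if_neg (by simpa using h), step_goto, if_pos rfl]
  · simpa [TM.ite] using h2
  · simpa [TM.ite] using h3

theorem run_loop_stop (h : (T i).head = s) : (TM.loop i s A).Run T T 1 := by
  refine ⟨2, stepsTo_one ?_, ?_⟩
  · rw [loop, step_test, if_pos ⟨rfl, h⟩]
  · apply step_eq_none_of_state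
    intro r hr
    simp only [loop, List.mem_cons, List.mem_append] at hr
    rcases hr with rfl | rfl | hr | hr
    · simp
    · simp
    · exact ne_of_mem_mapStates (fun q' => by simp) r hr
    · exact ne_of_mem_exits (fun q' => by simp) r hr

/-- The two additional steps are the failed test and the return to state `0`. -/
theorem run_loop_step (h : (T i).head ≠ s) (hA : A.Run T T' t)
    (hL : (TM.loop i s A).Run T' T'' t') : (TM.loop i s A).Run T T'' (t + 2 + t') := by
  obtain ⟨q, h2, h3⟩ := hL
  refine ⟨q, stepsTo_trans ?_ h2, h3⟩
  have h1 := run_embed_exits (f := fun q => 2 * q + 1) (fun a b h => by simpa using h)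
    (A := [(0, test i s, 2), (0, [], 1)]) (B := []) (x := 0) (by simp) hA
  have h0 : (TM.loop i s A).step ⟨0, T⟩ = some ⟨1, T⟩ := by
    rw [loop, step_test, if_neg (by simpa using h), step_goto, if_pos rfl]
  rw [show t + 2 = 1 + (t + 1) by omega]
  refine stepsTo_trans (stepsTo_one h0) ?_
  simpa [TM.loop] using h1

theorem run_nil : TM.Run [] T T 0 := ⟨0, rfl, rfl⟩

theorem run_act {w : Option ℕ} {m : Option Bool} :
    (TM.act i w m).Run T (Function.update T i (TapeAction.perform (none, w, m) (T i))) 1 := by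
  refine ⟨1, stepsTo_one ?_, ?_⟩
  · rw [act, step_single, if_pos (by simp)]
  · rw [act, step_single, if_neg (by simp)]
    rfl

theorem run_relabel {l : List (ℕ × ℕ)} {p : ℕ × ℕ} (hp : p ∈ l) (h : (T i).head = p.1)
    (huniq : ∀ p' ∈ l, p'.1 = p.1 → p' = p) :
    (TM.relabel i l).Run T (Function.update T i ((T i).write p.2)) 1 := by
  refine ⟨1, stepsTo_one ?_, ?_⟩
  · induction l with
    | nil => simp at hp
    | cons p' l ih =>
      have e : relabel i (p' :: l) =
        (0, List.replicate i (none, none, none) ++ [(some p'.1, some p'.2, none)], 1) ::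
          relabel i l := rfl
      rw [e, step_single]
      split_ifs with h'
      · obtain rfl := huniq p' List.mem_cons_self (by rw [← h, h'.2 _ rfl])
        rfl
      · rcases List.mem_cons.1 hp with rfl | hp
        · simp [h] at h'
        · exact ih hp fun p' hp' => huniq p' (List.mem_cons_of_mem _ hp')
  · apply step_eq_none_of_state
    intro r hr
    obtain ⟨p, _, rfl⟩ := List.mem_map.1 hr
    simp

theorem step_shift {M : TM} {q : ℕ} :
    (M.shift s).step ⟨q, T⟩ = (M.step ⟨q, fun i => T (s + i)⟩).map fun c =>
      ⟨c.state, fun i => if i < s then T i else c.tape (i - s)⟩ := by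
  induction M with
  | nil => rfl
  | cons r M ih =>
    obtain ⟨a, l, b⟩ := r
    have e : shift s ((a, l, b) :: M) =
      (a, List.replicate s (none, none, none) ++ l, b) :: shift s M := rfl
    have hget : ∀ j, (List.replicate s ((none, none, none) : TapeAction) ++ l).getD j
        (none, none, none) = if j < s then (none, none, none) else
          l.getD (j - s) (none, none, none) := by
      intro j
      split_ifs with h
      · rw [List.getD_append _ _ _ _ (by simpa using h)]
        simp [h]
      · rw [List.getD_append_right _ _ _ _ (by simpa using h)]
        simp
    have h : TMRule.Applies (a, List.replicate s (none, none, none) ++ l, b) ⟨q, T⟩ ↔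
        TMRule.Applies (a, l, b) ⟨q, fun i => T (s + i)⟩ := by
      simp only [TMRule.Applies, TMRule.action, hget]
      refine and_congr_right fun _ => ⟨fun H i hi s' hs => ?_, fun H i hi s' hs => ?_⟩
      · refine H (s + i) (by simpa using hi) s' ?_
        simpa using hs
      · split_ifs at hs with h'
        have := H (i - s) (by simp at hi; omega) s' hs
        simpa [Nat.add_sub_cancel' (not_lt.1 h')] using this
    rw [e, step_cons, step_cons, ih]
    simp only [h]
    split_ifs
    · simp only [Option.map_some, TMRule.action, hget]
      congr 2
      funext i
      split_ifs with h'
      · rfl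
      · simp [Nat.add_sub_cancel' (not_lt.1 h')]
    · rfl

theorem Run.shift {M : TM} (h : M.Run (fun i => T (s + i)) (fun i => T' (s + i)) t)
    (hT : ∀ i < s, T' i = T i) : (M.shift s).Run T T' t := by
  have key : ∀ {t q q' : ℕ} {T : ℕ → Turing.Tape ℕ} {S : ℕ → Turing.Tape ℕ},
      M.StepsTo t ⟨q, fun i => T (s + i)⟩ ⟨q', S⟩ →
      (M.shift s).StepsTo t ⟨q, T⟩ ⟨q', fun i => if i < s then T i else S (i - s)⟩ := by
    intro t
    induction t with
    | zero =>
      intro q q' T S h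
      cases h
      show TMConfig.mk _ _ = TMConfig.mk _ _
      congr 1
      funext i
      split_ifs with h'
      · rfl
      · simp [Nat.add_sub_cancel' (not_lt.1 h')]
    | succ t ih =>
      intro q q' T S h
      obtain ⟨c, h1, h2⟩ := h
      refine ⟨⟨c.state, fun i => if i < s then T i else c.tape (i - s)⟩, ?_, ?_⟩
      · rw [step_shift, h1]; rfl
      · have := @ih c.state q' (fun i => if i < s then T i else c.tape (i - s)) S (by
          simpa using h2)
        convert this using 3 with i
        split_ifs <;> rfl
  obtain ⟨q, h1, h2⟩ := h
  refine ⟨q, ?_, ?_⟩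
  · convert key h1 using 3 with i
    split_ifs with h'
    · exact hT i h'
    · simp [Nat.add_sub_cancel' (not_lt.1 h')]
  · rw [step_shift, h2]; rfl

/-! ### The combinations are computable -/

section Primrec
variable {α : Type*} [Primcodable α] {f g : α → TM}

theorem primrec_mapStates {k : ℕ → ℕ} (hk : Primrec k) : Primrec (mapStates k) := by
  refine Primrec.list_map Primrec.id ?_
  unfold Primrec₂
  have h : Primrec fun p : TM × TMRule => p.2 := Primrec.snd
  exact (hk.comp (Primrec.fst.comp h)).pair ((Primrec.fst.comp (Primrec.snd.comp h)).pair
    (hk.comp (Primrec.snd.comp (Primrec.snd.comp h))))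

theorem primrec_exits {k : ℕ → ℕ} (hk : Primrec k) (x : ℕ) : Primrec (exits k x) := by
  refine Primrec.list_cons.comp (Primrec.const _)
    (Primrec.list_map Primrec.id ?_)
  unfold Primrec₂
  have h : Primrec fun p : TM × TMRule => p.2 := Primrec.snd
  exact (hk.comp (Primrec.snd.comp (Primrec.snd.comp h))).pair (Primrec.const _)

theorem primrec_two_mul_add (c : ℕ) : Primrec fun q : ℕ => 2 * q + c :=
  Primrec.nat_add.comp (Primrec.nat_mul.comp (Primrec.const 2) Primrec.id) (Primrec.const c)

theorem primrec_seq (hf : Primrec f) (hg : Primrec g) : Primrec fun a => (f a).seq (g a) :=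
  Primrec.list_append.comp ((primrec_mapStates (primrec_two_mul_add 0)).comp hf)
    (Primrec.list_append.comp ((primrec_exits (primrec_two_mul_add 0) 1).comp hf)
      ((primrec_mapStates (primrec_two_mul_add 1)).comp hg))

theorem primrec_ite (i s : ℕ) (hf : Primrec f) (hg : Primrec g) :
    Primrec fun a => TM.ite i s (f a) (g a) :=
  Primrec.list_cons.comp (Primrec.const _) (Primrec.list_cons.comp (Primrec.const _)
    (Primrec.list_append.comp ((primrec_mapStates (primrec_two_mul_add 1)).comp hf)
      ((primrec_mapStates (primrec_two_mul_add 2)).comp hg)))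

theorem primrec_loop (i s : ℕ) (hf : Primrec f) : Primrec fun a => TM.loop i s (f a) :=
  Primrec.list_cons.comp (Primrec.const _) (Primrec.list_cons.comp (Primrec.const _)
    (Primrec.list_append.comp ((primrec_mapStates (primrec_two_mul_add 1)).comp hf)
      ((primrec_exits (primrec_two_mul_add 1) 0).comp hf)))

theorem primrec_shift (s : ℕ) (hf : Primrec f) : Primrec fun a => (f a).shift s := by
  refine Primrec.list_map hf ?_
  unfold Primrec₂
  have h : Primrec fun p : α × TMRule => p.2 := Primrec.snd
  exact (Primrec.fst.comp h).pair ((Primrec.list_append.comp (Primrec.const _)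
    (Primrec.fst.comp (Primrec.snd.comp h))).pair (Primrec.snd.comp (Primrec.snd.comp h)))

theorem primrec_relabel (i : ℕ) {l : α → List (ℕ × ℕ)} (hl : Primrec l) :
    Primrec fun a => relabel i (l a) := by
  refine Primrec.list_map hl ?_
  unfold Primrec₂
  have h : Primrec fun p : α × (ℕ × ℕ) => p.2 := Primrec.snd
  have h1 : Primrec fun p : α × (ℕ × ℕ) =>
      ((some p.2.1, some p.2.2, none) : TapeAction) :=
    (Primrec.option_some.comp (Primrec.fst.comp h)).pair
      ((Primrec.option_some.comp (Primrec.snd.comp h)).pair (Primrec.const _))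
  exact (Primrec.const _).pair ((Primrec.list_append.comp (Primrec.const _)
    (Primrec.list_cons.comp h1 (Primrec.const _))).pair (Primrec.const _))

end Primrec

end TM

/-! ### Tapes as stacks -/

/-- Names for the first thirteen tapes. -/
inductive Reg
  | io | x | y | c | z | a | w | v | u | i | t | n | g
  deriving DecidableEq

/-- The words on the first thirteen tapes, all heads being on the first symbol. -/
structure Regs where
  (io x y c z a w v u i t n g : List ℕ := [])

/-- The number of a tape. -/
def Reg.idx : Reg → ℕ
  | .io => 0 | .x => 1 | .y => 2 | .c => 3 | .z => 4 | .a => 5 | .w => 6 | .v => 7 | .u => 8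
  | .i => 9 | .t => 10 | .n => 11 | .g => 12

namespace Regs

/-- The word on a tape. -/
def get (s : Regs) : Reg → List ℕ
  | .io => s.io | .x => s.x | .y => s.y | .c => s.c | .z => s.z | .a => s.a | .w => s.w
  | .v => s.v | .u => s.u | .i => s.i | .t => s.t | .n => s.n | .g => s.g

/-- Replace the word on a tape. -/
def set (s : Regs) : Reg → List ℕ → Regs
  | .io, l => { s with io := l } | .x, l => { s with x := l } | .y, l => { s with y := l }
  | .c, l => { s with c := l } | .z, l => { s with z := l } | .a, l => { s with a := l }
  | .w, l => { s with w := l } | .v, l => { s with v := l } | .u, l => { s with u := l }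
  | .i, l => { s with i := l } | .t, l => { s with t := l } | .n, l => { s with n := l }
  | .g, l => { s with g := l }

/-- The words on all the tapes. -/
def word (s : Regs) : ℕ → List ℕ
  | 0 => s.io | 1 => s.x | 2 => s.y | 3 => s.c | 4 => s.z | 5 => s.a | 6 => s.w
  | 7 => s.v | 8 => s.u | 9 => s.i | 10 => s.t | 11 => s.n | 12 => s.g | _ => []

/-- The tapes. -/
noncomputable def tapes (s : Regs) (j : ℕ) : Turing.Tape ℕ := Turing.Tape.mk₁ (s.word j)

theorem get_set (s : Regs) (r q : Reg) (l : List ℕ) :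
    (s.set r l).get q = if q = r then l else s.get q := by
  cases r <;> cases q <;> rfl

theorem ext_get {s s' : Regs} (h : ∀ r, s.get r = s'.get r) : s = s' := by
  cases s; cases s'
  rw [mk.injEq]
  exact ⟨h .io, h .x, h .y, h .c, h .z, h .a, h .w, h .v, h .u, h .i, h .t, h .n, h .g⟩

theorem word_idx (s : Regs) (r : Reg) : s.word r.idx = s.get r := by cases r <;> rfl

theorem word_set (s : Regs) (r : Reg) (l : List ℕ) :
    (s.set r l).word = Function.update s.word r.idx l := by
  funext j
  rw [Function.update_apply]
  rcases j with _|_|_|_|_|_|_|_|_|_|_|_|_|j <;> cases r <;> rfl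

theorem tapes_set (s : Regs) (r : Reg) (l : List ℕ) :
    (s.set r l).tapes = Function.update s.tapes r.idx (Turing.Tape.mk₁ l) := by
  funext j
  simp only [tapes, word_set, Function.update_apply]
  split_ifs <;> rfl

theorem head_tapes (s : Regs) (r : Reg) : (s.tapes r.idx).head = (s.get r).headI := by
  rw [tapes, word_idx]; rfl

end Regs

/-! ### Stack operations, their effect and their cost -/

theorem push_mk₁ (l : List ℕ) (b : ℕ) :
    ((Turing.Tape.mk₁ l).move Turing.Dir.left).write b = Turing.Tape.mk₁ (b :: l) := by
  simp only [Turing.Tape.mk₁, Turing.Tape.mk₂, Turing.Tape.move_left_mk', Turing.Tape.write_mk',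
    Turing.ListBlank.cons_mk]
  rfl

/-- Blanking the cell before moving right leaves nothing to the left of the head, so the tape is
again in standard position. This also covers the empty stack. -/
theorem pop_mk₁ (l : List ℕ) :
    ((Turing.Tape.mk₁ l).write 0).move Turing.Dir.right = Turing.Tape.mk₁ l.tail := by
  have h : (Turing.ListBlank.mk [] : Turing.ListBlank ℕ).cons 0 = Turing.ListBlank.mk [] :=
    Turing.ListBlank.cons_head_tail (Turing.ListBlank.mk ([] : List ℕ))
  rw [Turing.Tape.mk₁, Turing.Tape.mk₂,
    ← Turing.ListBlank.cons_head_tail (Turing.ListBlank.mk l), Turing.Tape.write_mk',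
    Turing.Tape.move_right_mk']
  simp only [Turing.ListBlank.head_cons, Turing.ListBlank.tail_cons, Turing.ListBlank.tail_mk, h]
  rfl

theorem replace_mk₁ (l : List ℕ) (b b' : ℕ) :
    (Turing.Tape.mk₁ (b :: l)).write b' = Turing.Tape.mk₁ (b' :: l) := rfl

/-- The machine `M` turns the words `s` into `s'` in at most `t` steps. -/
def Does (M : TM) (s s' : Regs) (t : ℕ) : Prop := ∃ t' ≤ t, M.Run s.tapes s'.tapes t'

section Does
variable {A B : TM} {s s' s'' : Regs} {t t' b : ℕ} {r : Reg}

theorem Does.mono (h : Does A s s' t) (ht : t ≤ t') : Does A s s' t' :=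
  let ⟨k, hk, h⟩ := h; ⟨k, hk.trans ht, h⟩

theorem Does.congr_right (h : Does A s s' t) (hs : s' = s'') : Does A s s'' t := hs ▸ h

theorem Does.seq (h : Does A s s' t) (h' : Does B s' s'' t') :
    Does (A.seq B) s s'' (t + t' + 1) :=
  let ⟨k, hk, h⟩ := h; let ⟨k', hk', h'⟩ := h'; ⟨k + 1 + k', by omega, h.seq h'⟩

theorem Does.ite_pos (h : Does A s s' t) (hs : (s.get r).headI = b) :
    Does (TM.ite r.idx b A B) s s' (t + 1) :=
  let ⟨k, hk, h⟩ := h; ⟨1 + k, by omega, h.ite_pos (by rw [Regs.head_tapes, hs])⟩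

theorem Does.ite_neg (h : Does B s s' t) (hs : (s.get r).headI ≠ b) :
    Does (TM.ite r.idx b A B) s s' (t + 1) :=
  let ⟨k, hk, h⟩ := h; ⟨1 + k, by omega, h.ite_neg (by rwa [Regs.head_tapes])⟩

theorem does_loop_stop (hs : (s.get r).headI = b) : Does (TM.loop r.idx b A) s s 1 :=
  ⟨1, le_rfl, TM.run_loop_stop (by rw [Regs.head_tapes, hs])⟩

theorem does_loop_step (hs : (s.get r).headI ≠ b) (h : Does A s s' t)
    (h' : Does (TM.loop r.idx b A) s' s'' t') : Does (TM.loop r.idx b A) s s'' (t + 2 + t') :=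
  let ⟨k, hk, h⟩ := h; let ⟨k', hk', h'⟩ := h'
  ⟨k + 2 + k', by omega, TM.run_loop_step (by rwa [Regs.head_tapes]) h h'⟩

/-- A loop that runs through the configurations `P 0`, …, `P k`. -/
theorem does_loop (P : ℕ → Regs) (k : ℕ) (h0 : P 0 = s) (h1 : P k = s')
    (hk : (s'.get r).headI = b) (h : ∀ j < k, ((P j).get r).headI ≠ b)
    (hA : ∀ j < k, Does A (P j) (P (j + 1)) t) :
    Does (TM.loop r.idx b A) s s' (k * (t + 2) + 1) := by
  induction k generalizing P s with
  | zero =>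
    rw [← h1] at hk
    simpa [← h0, ← h1] using does_loop_stop hk
  | succ k ih =>
    have := ih (fun j => P (j + 1)) rfl h1 (fun j hj => h (j + 1) (by omega))
      (fun j hj => hA (j + 1) (by omega))
    rw [← h0]
    exact (does_loop_step (h 0 (by omega)) (hA 0 (by omega)) this).mono (by ring_nf; omega)

end Does

/-- Programs without loops. -/
inductive Prog
  | nop
  | push (r : Reg) (b : ℕ)
  | pop (r : Reg)
  | seq (p q : Prog)
  | ite (r : Reg) (b : ℕ) (p q : Prog)

namespace Prog

/-- The machine that carries out a program. -/
def tm : Prog → TM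
  | nop => []
  | push r b => (TM.act r.idx none (some false)).seq (TM.act r.idx (some b) none)
  | pop r => TM.act r.idx (some 0) (some true)
  | seq p q => p.tm.seq q.tm
  | ite r b p q => TM.ite r.idx b p.tm q.tm

/-- The effect of a program. -/
def exec : Prog → Regs → Regs
  | nop, s => s
  | push r b, s => s.set r (b :: s.get r)
  | pop r, s => s.set r (s.get r).tail
  | seq p q, s => q.exec (p.exec s)
  | ite r b p q, s => if (s.get r).headI = b then p.exec s else q.exec s

/-- A bound for the running time of a program. -/
def cost : Prog → ℕ
  | nop => 0
  | push _ _ => 3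
  | pop _ => 1
  | seq p q => p.cost + q.cost + 1
  | ite _ _ p q => max p.cost q.cost + 1

theorem does (p : Prog) (s : Regs) : Does p.tm s (p.exec s) p.cost := by
  induction p generalizing s with
  | nop => exact ⟨0, le_rfl, TM.run_nil⟩
  | push r b =>
    refine ⟨3, le_rfl, ?_⟩
    have := (TM.run_act (T := s.tapes) (i := r.idx) (w := none) (m := some false)).seq
      (TM.run_act (i := r.idx) (w := some b) (m := none))
    rw [tm]
    convert this using 1
    simp only [exec, Regs.tapes_set, Function.update_self, Function.update_idem]
    congr 1
    rw [← Regs.word_idx]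
    exact (push_mk₁ _ _).symm
  | pop r =>
    refine ⟨1, le_rfl, ?_⟩
    rw [tm]
    convert TM.run_act using 1
    simp only [exec, Regs.tapes_set]
    congr 1
    rw [← Regs.word_idx]
    exact (pop_mk₁ _).symm
  | seq p q hp hq => exact (hp s).seq (hq _)
  | ite r b p q hp hq =>
    rw [exec]
    split_ifs with h
    · exact ((hp s).mono (le_max_left _ _)).ite_pos h
    · exact ((hq s).mono (le_max_right _ _)).ite_neg h

theorem does' {p : Prog} {s s' : Regs} (h : p.exec s = s') : Does p.tm s s' p.cost :=
  h ▸ p.does s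

end Prog

theorem does_relabel {r : Reg} {l : List (ℕ × ℕ)} {b b' : ℕ} {s : Regs} {w : List ℕ}
    (hs : s.get r = b :: w) (hl : (b, b') ∈ l) (hu : ∀ p ∈ l, p.1 = b → p = (b, b')) :
    Does (TM.relabel r.idx l) s (s.set r (b' :: w)) 1 := by
  refine ⟨1, le_rfl, ?_⟩
  convert TM.run_relabel hl (by rw [Regs.head_tapes, hs]; rfl) hu using 1
  rw [Regs.tapes_set, Regs.tapes, Regs.word_idx, hs, replace_mk₁]

/-- Tape `0` of `M` becomes the register `g`, and its work tapes lie beyond all registers. As they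
are blank before and after a run, `M` can be called repeatedly. -/
theorem does_shift {M : TM} {u v : List ℕ} {t : ℕ} (h : M.Computes u v t) {s : Regs}
    (hs : s.g = u) : Does (M.shift 12) s { s with g := v } t := by
  obtain ⟨q, h1, h2⟩ := h
  have e : ∀ q' u' (s' : Regs), s'.g = u' →
      TMConfig.ofWord q' u' = ⟨q', fun i => s'.tapes (12 + i)⟩ := by
    intro q' u' s' hs'
    simp only [TMConfig.ofWord, TMConfig.mk.injEq, true_and]
    funext i
    rcases i with _ | i
    · simp [Regs.tapes, Regs.word, hs']
    · rw [show 12 + (i + 1) = i + 13 by omega]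
      rfl
  refine ⟨t, le_rfl, TM.Run.shift ⟨q, ?_, ?_⟩ ?_⟩
  · rw [← e 0 u s hs, ← e q v { s with g := v } rfl]; exact h1
  · rw [← e q v { s with g := v } rfl]; exact h2
  · intro i hi
    interval_cases i <;> rfl

theorem Does.computes {M : TM} {u v : List ℕ} {t : ℕ} (h : Does M { io := u } { io := v } t) :
    ∃ t' ≤ t, M.Computes u v t' := by
  obtain ⟨t', ht, q, h1, h2⟩ := h
  have e : ∀ q' u', TMConfig.ofWord q' u' = ⟨q', Regs.tapes { io := u' }⟩ := by
    intro q' u'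
    simp only [TMConfig.ofWord, TMConfig.mk.injEq, true_and]
    funext i
    rcases i with _|_|_|_|_|_|_|_|_|_|_|_|_|i <;> rfl
  exact ⟨t', ht, q, by rw [e, e]; exact h1, by rw [e]; exact h2⟩

/-! ### Words for numbers -/

/-- The `k` lowest binary digits of `m`, most significant digit first. -/
def lowDigits (m : ℕ) : ℕ → List ℕ
  | 0 => []
  | k + 1 => (m / 2 ^ k % 2 + 1) :: lowDigits m k

/-- Unary notation. -/
def unary (k : ℕ) : List ℕ := List.replicate k 1

theorem binaryNat_zero : binaryNat 0 = [] := by simp [binaryNat]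

theorem binaryNat_two_mul {m : ℕ} (h : m ≠ 0) : binaryNat (2 * m) = 1 :: binaryNat m := by
  simp [binaryNat, Nat.bit0_bits m h]

theorem binaryNat_two_mul_add_one (m : ℕ) : binaryNat (2 * m + 1) = 2 :: binaryNat m := by
  simp [binaryNat]

theorem binaryNat_of_ne_zero {m : ℕ} (h : m ≠ 0) :
    binaryNat m = (m % 2 + 1) :: binaryNat (m / 2) := by
  rcases Nat.even_or_odd' m with ⟨k, rfl | rfl⟩
  · rw [binaryNat_two_mul (by omega)]
    simp
  · rw [binaryNat_two_mul_add_one, show (2 * k + 1) / 2 = k by omega]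
    simp

theorem headI_binaryNat (m : ℕ) : (binaryNat m).headI = if m = 0 then 0 else m % 2 + 1 := by
  split_ifs with h
  · subst h; rw [binaryNat_zero]; rfl
  · rw [binaryNat_of_ne_zero h]; rfl

theorem tail_binaryNat (m : ℕ) : (binaryNat m).tail = binaryNat (m / 2) := by
  by_cases h : m = 0
  · subst h; simp [binaryNat_zero]
  · rw [binaryNat_of_ne_zero h]; rfl

theorem unary_succ (k : ℕ) : unary (k + 1) = 1 :: unary k := rfl

theorem headI_unary (k : ℕ) : (unary k).headI = if k = 0 then 0 else 1 := by
  cases k <;> simp [unary]; rfl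

theorem tail_unary (k : ℕ) : (unary k).tail = unary (k - 1) := by
  simp [unary]

theorem div_two_pow_ne_zero {m k : ℕ} (h : k < m.size) : m / 2 ^ k ≠ 0 := by
  rw [Nat.lt_size] at h
  have := Nat.div_pos h (by positivity)
  omega

theorem div_two_pow_size (m : ℕ) : m / 2 ^ m.size = 0 :=
  Nat.div_eq_of_lt (Nat.lt_size_self m)

theorem mod_two_pow_size (m : ℕ) : m % 2 ^ m.size = m :=
  Nat.mod_eq_of_lt (Nat.lt_size_self m)

theorem size_div_two (m : ℕ) : (m / 2).size = m.size - 1 := by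
  rcases Nat.eq_zero_or_pos m with rfl | h
  · simp
  · rcases Nat.even_or_odd' m with ⟨k, rfl | rfl⟩
    · have := Nat.size_bit (b := false) (n := k) (by simp [Nat.bit]; omega)
      simp only [Nat.bit, cond_false] at this
      simp [this]
    · have := Nat.size_bit (b := true) (n := k) (by simp [Nat.bit])
      simp only [Nat.bit, cond_true] at this
      rw [show (2 * k + 1) / 2 = k by omega, this]
      simp

/-! ### Elementary routines -/

/-- A loop that consumes the digits of `m` on the stack `q`, most significant digit first. -/
theorem does_horner {A : TM} {q : Reg} {m M t : ℕ} {s s' : Regs} (Q : ℕ → List ℕ → Regs)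
    {k v : ℕ} (h0 : Q v (lowDigits m k) = s) (h1 : Q (v * 2 ^ k + m % 2 ^ k) [] = s')
    (hQ : ∀ v w, (Q v w).get q = w)
    (hA : ∀ v j, 2 * v + m / 2 ^ j % 2 ≤ M →
      Does A (Q v (lowDigits m (j + 1))) (Q (2 * v + m / 2 ^ j % 2) (lowDigits m j)) t)
    (hv : v * 2 ^ k + m % 2 ^ k ≤ M) :
    Does (TM.loop q.idx 0 A) s s' (k * (t + 2) + 1) := by
  induction k generalizing v s with
  | zero =>
    simp only [pow_zero, mul_one, Nat.mod_one, add_zero] at h1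
    subst h0; subst h1
    rw [zero_mul, zero_add]
    exact does_loop_stop (by rw [hQ]; rfl)
  | succ k ih =>
    have e : (2 * v + m / 2 ^ k % 2) * 2 ^ k + m % 2 ^ k = v * 2 ^ (k + 1) + m % 2 ^ (k + 1) := by
      rw [Nat.mod_pow_succ, pow_succ]; ring
    -- Horner values only grow, so every intermediate value is at most the final one. This allows a
    -- body whose cost depends on the value to be charged at the bound `M`.
    have h2 : 2 * v + m / 2 ^ k % 2 ≤ M := by
      refine le_trans ?_ (e.trans_le hv)
      exact (Nat.le_mul_of_pos_right _ (by positivity)).trans (Nat.le_add_right _ _)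
    have := does_loop_step (r := q) (b := 0) (by rw [hQ]; simp [lowDigits]) (hA v k h2)
      (ih rfl (by rw [e, h1]) (e.trans_le hv))
    rw [h0] at this
    exact this.mono (by ring_nf; omega)

/-- Move a binary number to the stack `t`, reversing it. -/
def drain (r : Reg) : TM :=
  TM.loop r.idx 0 (Prog.seq (.ite r 2 (.push .t 2) (.push .t 1)) (.pop r)).tm

/-- After `k` rounds `r` holds `m / 2 ^ k`, and `t` the `k` lowest digits with the most significant
on top, the order that Horner's rule needs. -/
theorem does_drain {r : Reg} (hr : r ≠ .t) {s : Regs} {m : ℕ} (hs : s.get r = binaryNat m)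
    (ht : s.get .t = []) :
    Does (drain r) s ((s.set r []).set .t (lowDigits m m.size)) (m.size * 8 + 1) := by
  refine does_loop (t := 6)
    (fun k => (s.set r (binaryNat (m / 2 ^ k))).set .t (lowDigits m k)) m.size ?_ ?_ ?_ ?_ ?_
  · apply Regs.ext_get
    intro q
    simp only [Regs.get_set, pow_zero, Nat.div_one]
    split_ifs with h1 h2
    · rw [h1, ht]; rfl
    · rw [h2, hs]
    · rfl
  · simp [div_two_pow_size, binaryNat_zero]
  · simp [Regs.get_set, hr]
  · intro j hj
    simp [Regs.get_set, hr, headI_binaryNat, div_two_pow_ne_zero hj]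
  · intro j hj
    apply Prog.does'
    have h0 := div_two_pow_ne_zero hj
    apply Regs.ext_get
    intro q
    have h2 : m / 2 ^ j % 2 = 0 ∨ m / 2 ^ j % 2 = 1 := by omega
    rcases h2 with h2 | h2 <;>
    · simp only [Prog.exec, Regs.get_set, hr, headI_binaryNat, h0, h2, lowDigits, if_true,
        if_false, pow_succ]
      by_cases h3 : q = .t
      · subst h3; simp [hr.symm, Regs.get_set]
      · by_cases h4 : q = r <;>
          simp [h3, h4, hr, Regs.get_set, tail_binaryNat, Nat.div_div_eq_div_mul]

/-- Put a digit in front of a binary number. -/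
def pushDigit (q r : Reg) : Prog := .ite q 2 (.push r 2) (.ite r 0 .nop (.push r 1))

/-- A digit zero is not pushed onto the empty word, since `binaryNat` has no leading zeros. -/
theorem exec_pushDigit {q r : Reg} {s : Regs} {v m : ℕ} {w : List ℕ}
    (hq : s.get q = (m % 2 + 1) :: w) (hr : s.get r = binaryNat v) :
    (pushDigit q r).exec s = s.set r (binaryNat (2 * v + m % 2)) := by
  have h2 : m % 2 = 0 ∨ m % 2 = 1 := by omega
  rcases h2 with h2 | h2
  · by_cases h : v = 0
    · subst h
      simp only [pushDigit, Prog.exec, hq, h2, hr, binaryNat_zero]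
      apply Regs.ext_get
      intro p
      simp [Regs.get_set]
      rintro rfl
      simp [hr, binaryNat_zero]
    · simp [pushDigit, Prog.exec, hq, h2, hr, binaryNat_two_mul h, headI_binaryNat, h]
  · simp [pushDigit, Prog.exec, hq, h2, hr, binaryNat_two_mul_add_one]

/-- Move digits from the stack `q` to the number `r`. -/
def undrain (q r : Reg) : TM := TM.loop q.idx 0 (Prog.seq (pushDigit q r) (.pop q)).tm

/-- Move digits from the stack `q` to the numbers `r` and `r'`. -/
def undrainTwo (q r r' : Reg) : TM :=
  TM.loop q.idx 0 (Prog.seq (.seq (pushDigit q r) (pushDigit q r')) (.pop q)).tm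

theorem does_undrain {q r : Reg} (hr : r ≠ q) {s : Regs} {m k : ℕ}
    (hs : s.get q = lowDigits m k) (h0 : s.get r = []) :
    Does (undrain q r) s ((s.set r (binaryNat (m % 2 ^ k))).set q []) (k * 9 + 1) := by
  refine does_horner (m := m) (M := m % 2 ^ k) (t := 7)
    (fun v w => (s.set r (binaryNat v)).set q w) (v := 0) (k := k)
    ?_ ?_ (by simp [Regs.get_set]) ?_ (by simp)
  · apply Regs.ext_get
    intro p
    simp only [Regs.get_set, binaryNat_zero]
    split_ifs with h1 h2
    · rw [h1, hs]
    · rw [h2, h0]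
    · rfl
  · simp
  · intro v j _
    apply Prog.does'
    rw [Prog.exec, exec_pushDigit (v := v) (m := m / 2 ^ j) (w := lowDigits m j)
      (by simp [Regs.get_set, lowDigits]) (by simp [Regs.get_set, hr])]
    apply Regs.ext_get
    intro p
    simp only [Prog.exec, Regs.get_set]
    by_cases h1 : p = q
    · subst h1; simp [hr.symm, lowDigits]
    · by_cases h2 : p = r <;> simp [h1, h2, hr]

theorem does_undrainTwo {q r r' : Reg} (hr : r ≠ q) (hr' : r' ≠ q) (hrr : r ≠ r') {s : Regs}
    {m k : ℕ} (hs : s.get q = lowDigits m k) (h0 : s.get r = []) (h0' : s.get r' = []) :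
    Does (undrainTwo q r r') s
      (((s.set r (binaryNat (m % 2 ^ k))).set r' (binaryNat (m % 2 ^ k))).set q [])
      (k * 15 + 1) := by
  refine does_horner (m := m) (M := m % 2 ^ k) (t := 13)
    (fun v w => ((s.set r (binaryNat v)).set r' (binaryNat v)).set q w) (v := 0) (k := k)
    ?_ ?_ (by simp [Regs.get_set]) ?_ (by simp)
  · apply Regs.ext_get
    intro p
    simp only [Regs.get_set, binaryNat_zero]
    split_ifs with h1 h2 h3
    · rw [h1, hs]
    · rw [h2, h0']
    · rw [h3, h0]
    · rfl
  · simp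
  · intro v j _
    apply Prog.does'
    simp only [Prog.exec]
    rw [exec_pushDigit (r := r) (v := v) (m := m / 2 ^ j) (w := lowDigits m j)
      (by simp [Regs.get_set, lowDigits]) (by simp [Regs.get_set, hr, hrr]),
      exec_pushDigit (r := r') (v := v) (m := m / 2 ^ j) (w := lowDigits m j)
      (by simp [Regs.get_set, lowDigits, hr.symm]) (by simp [Regs.get_set, hr', hrr.symm])]
    apply Regs.ext_get
    intro p
    simp only [Regs.get_set]
    by_cases h1 : p = q
    · subst h1; simp [hr.symm, hr'.symm, lowDigits]
    · by_cases h2 : p = r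
      · subst h2; simp [hr, hrr]
      · by_cases h3 : p = r' <;> simp [h1, h2, h3, hr']

/-- Empty a stack. -/
def clear (r : Reg) : TM := TM.loop r.idx 0 (Prog.pop r).tm

/-- The loop takes a blank for the bottom of the stack, so the word must not contain one. -/
theorem does_clear {r : Reg} {s : Regs} (hs : 0 ∉ s.get r) :
    Does (clear r) s (s.set r []) ((s.get r).length * 3 + 1) := by
  refine does_loop (t := 1) (fun k => s.set r ((s.get r).drop k)) (s.get r).length ?_ ?_ ?_ ?_ ?_
  · apply Regs.ext_get
    intro q
    simp only [Regs.get_set]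
    split_ifs with h
    · rw [h]; rfl
    · rfl
  · simp
  · simp [Regs.get_set]
  · intro j hj h
    simp only [Regs.get_set, if_true] at h
    rw [List.drop_eq_getElem_cons hj] at h
    exact hs (h ▸ List.getElem_mem hj)
  · intro j hj
    apply Prog.does'
    apply Regs.ext_get
    intro q
    simp only [Prog.exec, Regs.get_set]
    split_ifs <;> simp

theorem length_binaryNat (m : ℕ) : (binaryNat m).length = m.size := by
  simp [binaryNat, Nat.size_eq_bits_len]

theorem zero_notMem_binaryNat (m : ℕ) : 0 ∉ binaryNat m := by
  simp only [binaryNat, List.mem_map, not_exists, not_and]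
  intro b _
  cases b <;> simp

theorem does_clear_binaryNat {r : Reg} {s : Regs} {m : ℕ} (hs : s.get r = binaryNat m) :
    Does (clear r) s (s.set r []) (m.size * 3 + 1) := by
  rw [← length_binaryNat, ← hs]
  exact does_clear (hs ▸ zero_notMem_binaryNat m)

theorem does_clear_unary {r : Reg} {s : Regs} {m : ℕ} (hs : s.get r = unary m) :
    Does (clear r) s (s.set r []) (m * 3 + 1) := by
  have h : m = (s.get r).length := by simp [hs, unary]
  conv => arg 4; rw [h]
  refine does_clear ?_
  rw [hs, unary, List.mem_replicate]
  omega

/-! ### Arithmetic routines -/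

/-- Carry out `B` once for each symbol on the stack `r`, using the stack `q` to restore `r`. -/
def forEach (r q : Reg) (B : TM) : TM :=
  (TM.loop r.idx 0 (B.seq (Prog.seq (.pop r) (.push q 1)).tm)).seq
    (TM.loop q.idx 0 (Prog.seq (.pop q) (.push r 1)).tm)

/-- The family `P` describes the other registers, with `r` full and `q` empty. During round `j` the
`k` symbols are in fact split as `k - j` on `r` and `j` on `q`; a second loop moves them back. -/
theorem does_forEach {r q : Reg} (hrq : r ≠ q) {B : TM} {k t : ℕ} {s s' : Regs} (P : ℕ → Regs)
    (h0 : P 0 = s) (h1 : P k = s') (hr : ∀ j, (P j).get r = unary k) (hq : ∀ j, (P j).get q = [])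
    (hB : ∀ j < k, Does B (((P j).set r (unary (k - j))).set q (unary j))
      (((P (j + 1)).set r (unary (k - j))).set q (unary j)) t) :
    Does (forEach r q B) s s' (k * (t + 15) + 3) := by
  have e1 : Does (TM.loop r.idx 0 (B.seq (Prog.seq (.pop r) (.push q 1)).tm)) s
      (((P k).set r []).set q (unary k)) (k * (t + 5 + 1 + 2) + 1) := by
    refine does_loop (fun j => ((P j).set r (unary (k - j))).set q (unary j)) k ?_ ?_ ?_ ?_ ?_
    · rw [← h0]
      apply Regs.ext_get
      intro p
      simp only [Regs.get_set]
      split_ifs with h2 h3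
      · rw [h2, hq]; rfl
      · rw [h3, hr]; rfl
      · rfl
    · simp [unary]
    · simp [Regs.get_set, hrq]
    · intro j hj
      simp [Regs.get_set, hrq, headI_unary]
      omega
    · intro j hj
      refine (hB j hj).seq (Prog.does' ?_)
      apply Regs.ext_get
      intro p
      simp only [Prog.exec, Regs.get_set]
      by_cases h2 : p = q
      · subst h2; simp [hrq.symm, unary_succ]
      · by_cases h3 : p = r
        · subst h3; simp [hrq, tail_unary, Nat.sub_sub]
        · simp [h2, h3]
  have e2 : Does (TM.loop q.idx 0 (Prog.seq (.pop q) (.push r 1)).tm)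
      (((P k).set r []).set q (unary k)) s' (k * (5 + 2) + 1) := by
    refine does_loop (fun j => ((P k).set r (unary j)).set q (unary (k - j))) k ?_ ?_ ?_ ?_ ?_
    · rfl
    · rw [← h1]
      apply Regs.ext_get
      intro p
      simp only [Regs.get_set]
      split_ifs with h2 h3
      · rw [h2, hq, Nat.sub_self]; rfl
      · rw [h3, hr]
      · rfl
    · rw [← h1, hq]; rfl
    · intro j hj
      simp [Regs.get_set, headI_unary]
      omega
    · intro j hj
      refine Prog.does' ?_
      apply Regs.ext_get
      intro p
      simp only [Prog.exec, Regs.get_set]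
      by_cases h2 : p = q
      · subst h2; simp [hrq.symm, tail_unary, Nat.sub_sub]
      · by_cases h3 : p = r
        · subst h3; simp [hrq, unary_succ]
        · simp [h2, h3]
  exact (e1.seq e2).mono (by ring_nf; omega)

/-- Add the digits on top of `x` and `y`, and the carry. -/
def addDigits : Prog :=
  .seq (.ite .x 2 (.seq (.push .t 2) (.push .c 1)) (.ite .x 1 (.push .t 1) .nop)) <|
  .seq (.pop .x) <| .seq (.ite .y 2 (.push .c 1) .nop) <| .seq (.pop .y) <|
  .ite .c 0 (.push .z 1) <| .seq (.pop .c) <| .ite .c 0 (.push .z 2) <| .seq (.pop .c) <|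
  .ite .c 0 (.seq (.push .z 1) (.push .c 1)) (.push .z 2)

/-- The stack `c` first collects a mark for each digit one, on top of the carry; the number of
marks, at most three, then gives the digit of the sum and the new carry. The digits of `x` are saved
on `t`, an exhausted `x` adding none. -/
theorem exec_addDigits {s : Regs} {x y c : ℕ} (hx : s.x = binaryNat x) (hy : s.y = binaryNat y)
    (hc : s.c = unary c) (hc1 : c ≤ 1) :
    addDigits.exec s = { s with
      x := binaryNat (x / 2), y := binaryNat (y / 2), c := unary ((x % 2 + y % 2 + c) / 2)
      t := if x = 0 then s.t else (x % 2 + 1) :: s.t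
      z := ((x + y + c) % 2 + 1) :: s.z } := by
  have h1 : (x + y + c) % 2 = (x % 2 + y % 2 + c) % 2 := by omega
  rw [h1]
  have hx' : x = 0 ∨ x ≠ 0 ∧ (x % 2 = 0 ∨ x % 2 = 1) := by omega
  have hy' : y = 0 ∨ y ≠ 0 ∧ (y % 2 = 0 ∨ y % 2 = 1) := by omega
  have hc' : c = 0 ∨ c = 1 := by omega
  rcases hx' with rfl | ⟨hx0, hx' | hx'⟩ <;> rcases hy' with rfl | ⟨hy0, hy' | hy'⟩ <;>
    rcases hc' with rfl | rfl <;>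
    simp_all [addDigits, Prog.exec, Regs.get, Regs.set, headI_binaryNat, tail_binaryNat, unary,
      List.replicate]

/-- Replace `y` by `x + y + c`, the carry `c` being in unary notation. -/
def adder : TM :=
  (TM.loop Reg.x.idx 0 addDigits.tm).seq <| (TM.loop Reg.y.idx 0 addDigits.tm).seq <|
  (Prog.ite .c 0 .nop (.seq (.pop .c) (.push .z 2))).tm.seq <|
  (undrain .z .y).seq (undrain .t .x)

/-- Invariant: `k` digits of the sum `S` are on `z`, and what remains of the summands and the carry
adds up to `S / 2 ^ k`. Here `y` is the remaining part of the second summand. -/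
theorem does_adder_x {s : Regs} {S x : ℕ} (j k y c : ℕ) (hj : k + j = x.size) (hc : c ≤ 1)
    (hS : x / 2 ^ k + y + c = S / 2 ^ k) :
    ∃ c' ≤ 1, y / 2 ^ j + c' = S / 2 ^ x.size ∧
      Does (TM.loop Reg.x.idx 0 addDigits.tm)
        { s with x := binaryNat (x / 2 ^ k), y := binaryNat y, c := unary c
                 t := lowDigits x k, z := lowDigits S k }
        { s with x := [], y := binaryNat (y / 2 ^ j), c := unary c'
                 t := lowDigits x x.size, z := lowDigits S x.size }
        (j * (addDigits.cost + 2) + 1) := by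
  induction j generalizing k y c with
  | zero =>
    obtain rfl : k = x.size := by omega
    refine ⟨c, hc, ?_, ?_⟩
    · rw [div_two_pow_size] at hS; simpa using hS
    · rw [div_two_pow_size, binaryNat_zero, pow_zero, Nat.div_one, zero_mul, zero_add]
      exact does_loop_stop rfl
  | succ j ih =>
    have h0 := div_two_pow_ne_zero (m := x) (k := k) (by omega)
    obtain ⟨c', hc', h1, h2⟩ := ih (k + 1) (y / 2) ((x / 2 ^ k % 2 + y % 2 + c) / 2) (by omega)
      (by omega) (by
        rw [pow_succ, ← Nat.div_div_eq_div_mul, ← Nat.div_div_eq_div_mul, ← hS]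
        omega)
    rw [Nat.div_div_eq_div_mul, ← pow_succ'] at h1 h2
    refine ⟨c', hc', h1, ?_⟩
    refine (does_loop_step (r := .x) ?_ (Prog.does' ?_) h2).mono ?_
    · simp [Regs.get, headI_binaryNat, h0]
    · rw [exec_addDigits rfl rfl rfl hc]
      simp [h0, lowDigits, hS, pow_succ, Nat.div_div_eq_div_mul]
    · ring_nf; omega

theorem does_adder_y {s : Regs} {S : ℕ} (j k y c : ℕ) (hj : y.size = j) (hc : c ≤ 1)
    (hS : y + c = S / 2 ^ k) (hs : s.x = []) :
    ∃ c' ≤ 1, c' = S / 2 ^ (k + j) ∧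
      Does (TM.loop Reg.y.idx 0 addDigits.tm)
        { s with y := binaryNat y, c := unary c, z := lowDigits S k }
        { s with y := [], c := unary c', z := lowDigits S (k + j) }
        (j * (addDigits.cost + 2) + 1) := by
  induction j generalizing k y c with
  | zero =>
    obtain rfl : y = 0 := Nat.size_eq_zero.1 hj
    refine ⟨c, hc, by simpa using hS, ?_⟩
    rw [binaryNat_zero, zero_mul, zero_add, add_zero]
    exact does_loop_stop rfl
  | succ j ih =>
    have h0 : y ≠ 0 := by rintro rfl; simp at hj
    obtain ⟨c', hc', h1, h2⟩ := ih (k + 1) (y / 2) ((y % 2 + c) / 2)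
      (by rw [size_div_two]; omega) (by omega) (by
        rw [pow_succ, ← Nat.div_div_eq_div_mul, ← hS]
        omega)
    rw [show k + 1 + j = k + (j + 1) by omega] at h1 h2
    refine ⟨c', hc', h1, ?_⟩
    refine (does_loop_step (r := .y) ?_ (Prog.does' ?_) h2).mono ?_
    · simp [Regs.get, headI_binaryNat, h0]
    · rw [exec_addDigits (x := 0) (by simp [hs, binaryNat_zero]) rfl rfl hc]
      simp [lowDigits, hS, hs, binaryNat_zero]
    · ring_nf; omega

theorem does_adder {s : Regs} {x y c : ℕ} (hx : s.x = binaryNat x) (hy : s.y = binaryNat y)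
    (hc : s.c = unary c) (hc1 : c ≤ 1) (hz : s.z = []) (ht : s.t = []) :
    Does adder s { s with y := binaryNat (x + y + c), c := [] }
      (60 * (x.size + y.size) + 60) := by
  obtain ⟨⟩ := s
  subst hx hy hc hz ht
  generalize hs : Regs.mk _ _ _ _ _ _ _ _ _ _ _ _ _ = s
  obtain ⟨c', hc', h1, h2⟩ := does_adder_x (s := s) (S := x + y + c) (x := x) x.size 0 y c
    (by omega) hc1 (by simp)
  obtain ⟨c'', hc'', h3, h4⟩ := does_adder_y
    (s := { s with x := [], t := lowDigits x x.size }) (S := x + y + c) _ x.size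
    (y / 2 ^ x.size) c' rfl hc' h1 rfl
  have hsz : (y / 2 ^ x.size).size ≤ y.size := Nat.size_le_size (Nat.div_le_self _ _)
  set K := x.size + (y / 2 ^ x.size).size with hK
  -- A last carry becomes the leading digit, so the sum has `K` or `K + 1` digits on `z`.
  have h5 : ∃ K' ≤ K + 1, x + y + c < 2 ^ K' ∧
      Does (Prog.ite .c 0 .nop (.seq (.pop .c) (.push .z 2))).tm
        { s with x := [], t := lowDigits x x.size, y := [], c := unary c''
                 z := lowDigits (x + y + c) K }
        { s with x := [], t := lowDigits x x.size, y := [], c := []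
                 z := lowDigits (x + y + c) K' } 6 := by
    have : c'' = 0 ∨ c'' = 1 := by omega
    rcases this with rfl | rfl
    · refine ⟨K, by omega, ?_, Prog.does' rfl⟩
      exact (Nat.div_eq_zero_iff_lt (by positivity)).1 h3.symm
    · refine ⟨K + 1, le_rfl, ?_, Prog.does' ?_⟩
      · rw [pow_succ]
        have := Nat.lt_mul_div_succ (x + y + c) (show 0 < 2 ^ K by positivity)
        rwa [← h3] at this
      · simp [Prog.exec, Regs.get, Regs.set, unary, lowDigits, ← h3]
  obtain ⟨K', hK', hlt, h5⟩ := h5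
  have h6 := does_undrain (q := .z) (r := .y) (by decide) (s := { s with
    x := [], t := lowDigits x x.size, y := [], c := [], z := lowDigits (x + y + c) K' }) rfl rfl
  have h7 := does_undrain (q := .t) (r := .x) (by decide) (s := { s with
    x := [], t := lowDigits x x.size, y := binaryNat ((x + y + c) % 2 ^ K'), c := [], z := [] })
    rfl rfl
  rw [Nat.mod_eq_of_lt hlt] at h6
  rw [Nat.mod_eq_of_lt hlt, mod_two_pow_size] at h7
  have h := h2.seq (h4.seq (h5.seq (h6.seq h7)))
  subst hs
  rw [pow_zero, Nat.div_one] at h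
  refine h.mono ?_
  have : addDigits.cost = 32 := rfl
  rw [this]
  omega

/-- Double the unary number `a`. -/
def double : TM :=
  (TM.loop Reg.a.idx 0 (Prog.seq (.pop .a) (.seq (.push .z 1) (.push .z 1))).tm).seq
    (TM.loop Reg.z.idx 0 (Prog.seq (.pop .z) (.push .a 1)).tm)

theorem does_double {s : Regs} {k : ℕ} (ha : s.a = unary k) (hz : s.z = []) :
    Does double s { s with a := unary (2 * k) } (25 * k + 3) := by
  obtain ⟨⟩ := s
  subst ha hz
  generalize hs : Regs.mk _ _ _ _ _ _ _ _ _ _ _ _ _ = s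
  have e1 : Does (TM.loop Reg.a.idx 0
      (Prog.seq (.pop .a) (.seq (.push .z 1) (.push .z 1))).tm) s
      { s with a := [], z := unary (2 * k) } (k * (9 + 2) + 1) := by
    refine does_loop (fun j => { s with a := unary (k - j), z := unary (2 * j) }) k ?_ ?_ rfl ?_ ?_
    · subst hs; rfl
    · simp [unary]
    · intro j hj
      simp [Regs.get, headI_unary]
      omega
    · intro j hj
      refine Prog.does' ?_
      simp [Prog.exec, Regs.set, Regs.get, tail_unary, Nat.sub_sub, mul_add, unary_succ]
  have e2 : Does (TM.loop Reg.z.idx 0 (Prog.seq (.pop .z) (.push .a 1)).tm)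
      { s with a := [], z := unary (2 * k) } { s with a := unary (2 * k), z := [] }
      (2 * k * (5 + 2) + 1) := by
    refine does_loop (fun j => { s with a := unary j, z := unary (2 * k - j) }) (2 * k)
      rfl ?_ rfl ?_ ?_
    · simp [unary]
    · intro j hj
      simp [Regs.get, headI_unary]
      omega
    · intro j hj
      refine Prog.does' ?_
      simp [Prog.exec, Regs.set, Regs.get, tail_unary, Nat.sub_sub, unary_succ]
  subst hs
  exact (e1.seq e2).mono (by omega)

/-- Convert the binary number `g` to the unary number `a`. -/
def toUnary : TM :=
  (drain .g).seq (TM.loop Reg.t.idx 0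
    (double.seq (Prog.seq (.ite .t 2 (.push .a 1) .nop) (.pop .t)).tm))

theorem does_toUnary {s : Regs} {m : ℕ} (hg : s.g = binaryNat m) (ha : s.a = []) (hz : s.z = [])
    (ht : s.t = []) :
    Does toUnary s { s with g := [], a := unary m } (m.size * (25 * m + 30) + 3) := by
  obtain ⟨⟩ := s
  subst hg ha hz ht
  generalize hs : Regs.mk _ _ _ _ _ _ _ _ _ _ _ _ _ = s
  have e1 := does_drain (r := .g) (by decide) (s := s) (m := m) (by subst hs; rfl)
    (by subst hs; rfl)
  have e2 : Does (TM.loop Reg.t.idx 0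
      (double.seq (Prog.seq (.ite .t 2 (.push .a 1) .nop) (.pop .t)).tm))
      { s with g := [], t := lowDigits m m.size } { s with g := [], a := unary m, t := [] }
      (m.size * (25 * m + 3 + 6 + 1 + 2) + 1) := by
    refine does_horner (m := m) (M := m) (v := 0)
      (fun v w => { s with g := [], a := unary v, t := w }) ?_ ?_ (fun _ _ => rfl) ?_ ?_
    · subst hs; rfl
    · simp [mod_two_pow_size]
    · intro v j hv
      refine ((does_double (k := v) rfl (by subst hs; rfl)).mono (t' := 25 * m + 3) (by omega)).seq
        (Prog.does' ?_)
      have h2 : m / 2 ^ j % 2 = 0 ∨ m / 2 ^ j % 2 = 1 := by omega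
      rcases h2 with h2 | h2 <;>
        simp [Prog.exec, Regs.set, Regs.get, unary_succ, lowDigits, h2]
    · simp [mod_two_pow_size]
  subst hs
  exact (e1.seq e2).mono (by ring_nf; omega)

/-- Multiply the number `y` by `2 ^ w`. -/
def shiftLeft : TM := forEach .w .t (Prog.push .y 1).tm

/-- Doubling puts the digit zero (symbol `1`) in front; for `m = 0` this would not be the binary
notation of a number. -/
theorem does_shiftLeft {s : Regs} {k m : ℕ} (hw : s.w = unary k) (ht : s.t = [])
    (hy : s.y = binaryNat m) (hm : m ≠ 0) :
    Does shiftLeft s { s with y := binaryNat (2 ^ k * m) } (k * 18 + 3) := by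
  refine does_forEach (by decide) (t := 3) (fun j => { s with y := binaryNat (2 ^ j * m) })
    ?_ rfl (fun _ => hw) (fun _ => ht) ?_
  · obtain ⟨⟩ := s
    subst hy
    simp
  · intro j hj
    refine Prog.does' ?_
    have : 2 ^ j * m ≠ 0 := by positivity
    simp [Prog.exec, Regs.set, Regs.get, pow_succ', mul_assoc, binaryNat_two_mul this]

/-- Multiply the number `y` by `2 ^ (w * a)`. -/
def shiftLeftMul : TM := forEach .a .z shiftLeft

theorem does_shiftLeftMul {s : Regs} {k a m : ℕ} (hw : s.w = unary k) (ha : s.a = unary a)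
    (ht : s.t = []) (hz : s.z = []) (hy : s.y = binaryNat m) (hm : m ≠ 0) :
    Does shiftLeftMul s { s with y := binaryNat (2 ^ (k * a) * m) }
      (a * (k * 18 + 18) + 3) := by
  refine does_forEach (by decide) (t := k * 18 + 3)
    (fun j => { s with y := binaryNat (2 ^ (k * j) * m) }) ?_ rfl (fun _ => ha) (fun _ => hz) ?_
  · obtain ⟨⟩ := s
    subst hy
    simp
  · intro j hj
    refine (does_shiftLeft (s := Regs.set (Regs.set
      { s with y := binaryNat (2 ^ (k * j) * m) } .a (unary (a - j))) .z (unary j))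
      (k := k) hw ht rfl (by positivity)).congr_right ?_
    simp [Regs.set, mul_add, pow_add, mul_comm, mul_left_comm]

/-- The number `x * (1 + q + ⋯ + q ^ j)`, computed by Horner's rule. -/
def geomMul (q x : ℕ) : ℕ → ℕ
  | 0 => x
  | j + 1 => x + q * geomMul q x j

theorem geomMul_eq (q x j : ℕ) : geomMul q x j = x * ∑ k ∈ Finset.range (j + 1), q ^ k := by
  induction j with
  | zero => simp [geomMul]
  | succ j ih =>
    rw [geomMul, ih, Finset.sum_range_succ' _ (j + 1)]
    simp only [pow_succ, ← Finset.sum_mul]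
    ring

theorem geomMul_mono (q x : ℕ) : Monotone (geomMul q x) := by
  intro i j h
  rw [geomMul_eq, geomMul_eq]
  gcongr

/-- Starting from equal numbers `x` and `y`, multiply `y` by
`1 + 2 ^ (w * a) + ⋯ + 2 ^ (w * a * v)`. -/
def mulGeom : TM := forEach .v .io (shiftLeftMul.seq adder)

/-- Each round replaces `y` by `x + 2 ^ (w * a) * y`. By monotonicity of `geomMul` the length of the
final value bounds that of every summand. -/
theorem does_mulGeom {s : Regs} {k a n x L : ℕ} (hw : s.w = unary k) (ha : s.a = unary a)
    (hv : s.v = unary n) (ht : s.t = []) (hz : s.z = []) (hc : s.c = []) (hio : s.io = [])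
    (hx : s.x = binaryNat x) (hy : s.y = binaryNat x) (h0 : x ≠ 0)
    (hL : (geomMul (2 ^ (k * a)) x n).size ≤ L) :
    Does mulGeom s { s with y := binaryNat (geomMul (2 ^ (k * a)) x n) }
      (n * (a * (k * 18 + 18) + 120 * L + 79) + 3) := by
  have hpos : ∀ j, geomMul (2 ^ (k * a)) x j ≠ 0 := by
    intro j
    have := geomMul_mono (2 ^ (k * a)) x (Nat.zero_le j)
    rw [geomMul] at this
    omega
  refine (does_forEach (r := .v) (q := .io) (by decide) (t := a * (k * 18 + 18) + 120 * L + 64)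
    (fun j => { s with y := binaryNat (geomMul (2 ^ (k * a)) x j) }) ?_ rfl (fun _ => hv)
    (fun _ => hio) ?_).mono (by ring_nf; omega)
  · obtain ⟨⟩ := s
    subst hy
    rfl
  · intro j hj
    have h1 := does_shiftLeftMul (s := (Regs.set (Regs.set
      { s with y := binaryNat (geomMul (2 ^ (k * a)) x j) } .v (unary (n - j))) .io (unary j)))
      (k := k) hw ha ht hz rfl (hpos j)
    have h2 := does_adder (c := 0) (s := (Regs.set (Regs.set
      { s with y := binaryNat (2 ^ (k * a) * geomMul (2 ^ (k * a)) x j) }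
      .v (unary (n - j))) .io (unary j))) hx rfl hc (by omega) hz ht
    refine ((h1.seq h2).mono ?_).congr_right ?_
    · have h3 : geomMul (2 ^ (k * a)) x (j + 1) ≤ geomMul (2 ^ (k * a)) x n :=
        geomMul_mono _ _ hj
      have h4 : x ≤ geomMul (2 ^ (k * a)) x n := geomMul_mono _ _ (Nat.zero_le n)
      rw [geomMul] at h3
      have h5 := (Nat.size_le_size h4).trans hL
      have h6 := (Nat.size_le_size ((Nat.le_add_left _ _).trans h3)).trans hL
      omega
    · simp [Regs.set, geomMul, hc]

/-- From the unary number `a = n` prepare `u = v = n` and `w = n * (n + 1)`. -/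
def prepare : TM :=
  (TM.loop Reg.a.idx 0 (Prog.seq (.pop .a) (.seq (.push .u 1) (.push .v 1))).tm).seq <|
  forEach .u .z ((forEach .v .t (Prog.push .w 1).tm).seq (Prog.push .w 1).tm)

theorem does_prepare (n : ℕ) (i N : List ℕ) :
    Does prepare { a := unary n, i := i, n := N }
      { u := unary n, v := unary n, w := unary (n * (n + 1)), i := i, n := N }
      (n * (n * 18 + 40) + 10) := by
  have e1 : Does (TM.loop Reg.a.idx 0 (Prog.seq (.pop .a) (.seq (.push .u 1) (.push .v 1))).tm)
      { a := unary n, i := i, n := N } { u := unary n, v := unary n, i := i, n := N }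
      (n * (9 + 2) + 1) := by
    refine does_loop (fun j => { a := unary (n - j), u := unary j, v := unary j, i := i, n := N })
      n rfl (by simp [unary]) rfl ?_ ?_
    · intro j hj
      simp [Regs.get, headI_unary]
      omega
    · intro j hj
      refine Prog.does' ?_
      simp [Prog.exec, Regs.set, Regs.get, tail_unary, Nat.sub_sub, unary_succ]
  have e2 : Does (forEach .u .z ((forEach .v .t (Prog.push .w 1).tm).seq (Prog.push .w 1).tm))
      { u := unary n, v := unary n, i := i, n := N }
      { u := unary n, v := unary n, w := unary (n * (n + 1)), i := i, n := N }
      (n * (n * (3 + 15) + 3 + 3 + 1 + 15) + 3) := by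
    refine does_forEach (by decide)
      (fun j => { u := unary n, v := unary n, w := unary (j * (n + 1)), i := i, n := N })
      (by simp [unary]) rfl (fun _ => rfl) (fun _ => rfl) ?_
    intro j hj
    have h := does_forEach (r := .v) (q := .t) (by decide) (B := (Prog.push .w 1).tm) (k := n)
      (t := 3)
      (fun l => { u := unary (n - j), v := unary n, w := unary (j * (n + 1) + l)
                  z := unary j, i := i, n := N }) rfl rfl (fun _ => rfl) (fun _ => rfl)
        (fun l _ => Prog.does' rfl)
    refine (h.seq ((Prog.push .w 1).does _)).congr_right ?_
    simp only [Prog.exec, Regs.set, Regs.get, ← unary_succ]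
    simp only [add_mul, one_mul, add_assoc]
  exact (e1.seq e2).mono (by ring_nf; omega)

/-- Replace `n` by `n / 2 ^ (w * v) % 2 ^ w`, to be left on `io`, and clear `v`, `w` and `i`. -/
def extract : TM :=
  (forEach .v .z (forEach .w .t (Prog.pop .n).tm)).seq <|
  (forEach .w .t (Prog.seq (.ite .n 2 (.push .z 2) (.push .z 1)) (.pop .n)).tm).seq <|
  (undrain .z .io).seq <| (clear .n).seq <| (clear .w).seq <| (clear .v).seq (clear .i)

theorem does_extract (n w N i : ℕ) :
    Does extract { v := unary n, w := unary w, n := binaryNat N, i := binaryNat i }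
      { io := binaryNat (N / 2 ^ (w * n) % 2 ^ w) }
      (n * (w * 16 + 18) + w * 40 + 3 * N.size + 3 * n + 3 * i.size + 30) := by
  have e1 : Does (forEach .v .z (forEach .w .t (Prog.pop .n).tm))
      { v := unary n, w := unary w, n := binaryNat N, i := binaryNat i }
      { v := unary n, w := unary w, n := binaryNat (N / 2 ^ (w * n)), i := binaryNat i }
      (n * (w * (1 + 15) + 3 + 15) + 3) := by
    refine does_forEach (by decide)
      (fun j => { v := unary n, w := unary w, n := binaryNat (N / 2 ^ (w * j))
                  i := binaryNat i })
      (by simp) rfl (fun _ => rfl) (fun _ => rfl) ?_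
    intro j hj
    refine does_forEach (by decide)
      (fun l => { v := unary (n - j), w := unary w, n := binaryNat (N / 2 ^ (w * j + l))
                  z := unary j, i := binaryNat i })
      rfl rfl (fun _ => rfl) (fun _ => rfl) ?_
    intro l hl
    refine Prog.does' ?_
    simp [Prog.exec, Regs.set, Regs.get, tail_binaryNat, Nat.div_div_eq_div_mul, ← pow_succ,
      add_assoc]
  have h0 : N / 2 ^ (w * n) ≤ N := Nat.div_le_self _ _
  generalize N / 2 ^ (w * n) = m at e1 h0 ⊢
  have e2 : Does (forEach .w .t (Prog.seq (.ite .n 2 (.push .z 2) (.push .z 1)) (.pop .n)).tm)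
      { v := unary n, w := unary w, n := binaryNat m, i := binaryNat i }
      { v := unary n, w := unary w, n := binaryNat (m / 2 ^ w), z := lowDigits m w
        i := binaryNat i }
      (w * (6 + 15) + 3) := by
    refine does_forEach (by decide)
      (fun j => { v := unary n, w := unary w, n := binaryNat (m / 2 ^ j), z := lowDigits m j
                  i := binaryNat i })
      (by simp [lowDigits]) rfl (fun _ => rfl) (fun _ => rfl) ?_
    intro j hj
    refine Prog.does' ?_
    -- When the number is exhausted, zeros are supplied up to `w` digits; `undrain` drops them as
    -- leading zeros.
    have h2 : m / 2 ^ j = 0 ∨ m / 2 ^ j ≠ 0 ∧ (m / 2 ^ j % 2 = 0 ∨ m / 2 ^ j % 2 = 1) := by omega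
    rcases h2 with h2 | ⟨h3, h2 | h2⟩ <;>
      simp [Prog.exec, Regs.set, Regs.get, tail_binaryNat, headI_binaryNat, *, lowDigits, pow_succ,
        ← Nat.div_div_eq_div_mul]
  have e3 := does_undrain (q := .z) (r := .io) (by decide)
    (s := { v := unary n, w := unary w, n := binaryNat (m / 2 ^ w), z := lowDigits m w
            i := binaryNat i }) rfl rfl
  have e4 := does_clear_binaryNat (r := .n)
    (s := { v := unary n, w := unary w, n := binaryNat (m / 2 ^ w)
            io := binaryNat (m % 2 ^ w), i := binaryNat i }) rfl
  have e5 := does_clear_unary (r := .w)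
    (s := { v := unary n, w := unary w, io := binaryNat (m % 2 ^ w), i := binaryNat i }) rfl
  have e6 := does_clear_unary (r := .v)
    (s := { v := unary n, io := binaryNat (m % 2 ^ w), i := binaryNat i }) rfl
  have e7 := does_clear_binaryNat (r := .i)
    (s := { io := binaryNat (m % 2 ^ w), i := binaryNat i }) rfl
  refine (e1.seq (e2.seq (e3.seq (e4.seq (e5.seq (e6.seq e7)))))).mono ?_
  have h1 : (m / 2 ^ w).size ≤ N.size :=
    Nat.size_le_size ((Nat.div_le_self _ _).trans h0)
  rw [show n * (w * (1 + 15) + 3 + 15) = n * (w * 16 + 18) by ring]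
  omega

/-! ### The machine -/

/-- Increment the number `i` and copy it to `g`. -/
def increment : TM :=
  (drain .i).seq <| (undrain .t .y).seq <| (Prog.push .c 1).tm.seq <| adder.seq <|
  (drain .y).seq (undrainTwo .t .i .g)

theorem does_increment (k : ℕ) (u v w n : List ℕ) :
    Does increment { u := u, v := v, w := w, n := n, i := binaryNat k }
      { u := u, v := v, w := w, n := n, i := binaryNat (k + 1), g := binaryNat (k + 1) }
      (120 * (k + 1).size + 100) := by
  have e1 := does_drain (r := .i) (by decide)
    (s := { u := u, v := v, w := w, n := n, i := binaryNat k }) (m := k) rfl rfl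
  have e2 := does_undrain (q := .t) (r := .y) (by decide)
    (s := { u := u, v := v, w := w, n := n, t := lowDigits k k.size }) rfl rfl
  rw [mod_two_pow_size] at e2
  have e3 := (Prog.push .c 1).does { u := u, v := v, w := w, n := n, y := binaryNat k }
  -- The increment is the sum of `0`, `k` and an initial carry.
  have e4 := does_adder (x := 0) (y := k) (c := 1)
    (s := { u := u, v := v, w := w, n := n, y := binaryNat k, c := unary 1 })
    (by simp [binaryNat_zero]) rfl rfl le_rfl rfl rfl
  rw [zero_add] at e4
  have e5 := does_drain (r := .y) (by decide)
    (s := { u := u, v := v, w := w, n := n, y := binaryNat (k + 1) }) (m := k + 1) rfl rfl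
  have e6 := does_undrainTwo (q := .t) (r := .i) (r' := .g) (by decide) (by decide) (by decide)
    (s := { u := u, v := v, w := w, n := n, t := lowDigits (k + 1) (k + 1).size }) rfl rfl rfl
  rw [mod_two_pow_size] at e6
  refine (e1.seq (e2.seq (e3.seq (e4.seq (e5.seq e6))))).mono ?_
  have h : k.size ≤ (k + 1).size := Nat.size_le_size (by omega)
  have : (Prog.push .c 1).cost = 3 := rfl
  simp only [Nat.size_zero]
  omega

/-- One more factor: increment `i`, compute `g` from `i` by `M`, and multiply the number `n` by
`1 + 2 ^ (w * g) + ⋯ + 2 ^ (w * g * v)`. -/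
def factorStep (M : TM) : TM :=
  increment.seq <| (M.shift 12).seq <| toUnary.seq <| (drain .n).seq <|
  (undrainTwo .t .x .y).seq <| mulGeom.seq <| (clear .a).seq <| (clear .x).seq <|
  (drain .y).seq <| (undrain .t .n).seq (Prog.pop .u).tm

theorem does_factorStep {M : TM} {l a τ L : ℕ} (n W m N : ℕ)
    (hM : M.Computes (binaryNat (l + 1)) (binaryNat a) τ) (hN : N ≠ 0)
    (hL : (geomMul (2 ^ (W * a)) N n).size ≤ L) :
    Does (factorStep M)
      { u := unary (m + 1), v := unary n, w := unary W, i := binaryNat l, n := binaryNat N }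
      { u := unary m, v := unary n, w := unary W, i := binaryNat (l + 1)
        n := binaryNat (geomMul (2 ^ (W * a)) N n) }
      (120 * (l + 1) + τ + a * (25 * a + 33) + n * (a * (W * 18 + 18) + 120 * L + 79) + 60 * L
        + 200) := by
  have hNL : N.size ≤ L := (Nat.size_le_size (geomMul_mono _ _ (Nat.zero_le n))).trans hL
  have size_le : ∀ k : ℕ, k.size ≤ k := fun k => Nat.size_le.2 Nat.lt_two_pow_self
  have e1 := does_increment l (unary (m + 1)) (unary n) (unary W) (binaryNat N)
  have e2 := does_shift hM (s := { u := unary (m + 1), v := unary n, w := unary W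
                                   n := binaryNat N, i := binaryNat (l + 1)
                                   g := binaryNat (l + 1) }) rfl
  have e3 := does_toUnary (s := { u := unary (m + 1), v := unary n, w := unary W
                                  n := binaryNat N, i := binaryNat (l + 1)
                                  g := binaryNat a }) rfl rfl rfl rfl
  have e4 := does_drain (r := .n) (by decide) (m := N)
    (s := { u := unary (m + 1), v := unary n, w := unary W, n := binaryNat N
            i := binaryNat (l + 1), a := unary a }) rfl rfl
  have e5 := does_undrainTwo (q := .t) (r := .x) (r' := .y) (by decide) (by decide) (by decide)
    (m := N) (k := N.size)
    (s := { u := unary (m + 1), v := unary n, w := unary W, t := lowDigits N N.size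
            i := binaryNat (l + 1), a := unary a }) rfl rfl rfl
  rw [mod_two_pow_size] at e5
  have e6 := does_mulGeom (k := W) (a := a) (n := n) (x := N) (L := L)
    (s := { u := unary (m + 1), v := unary n, w := unary W, x := binaryNat N, y := binaryNat N
            i := binaryNat (l + 1), a := unary a }) rfl rfl rfl rfl rfl rfl rfl rfl rfl hN hL
  generalize geomMul (2 ^ (W * a)) N n = N' at e6 hL ⊢
  have e7 := does_clear_unary (r := .a) (m := a)
    (s := { u := unary (m + 1), v := unary n, w := unary W, x := binaryNat N, y := binaryNat N'
            i := binaryNat (l + 1), a := unary a }) rfl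
  have e8 := does_clear_binaryNat (r := .x) (m := N)
    (s := { u := unary (m + 1), v := unary n, w := unary W, x := binaryNat N, y := binaryNat N'
            i := binaryNat (l + 1) }) rfl
  have e9 := does_drain (r := .y) (by decide) (m := N')
    (s := { u := unary (m + 1), v := unary n, w := unary W, y := binaryNat N'
            i := binaryNat (l + 1) }) rfl rfl
  have e10 := does_undrain (q := .t) (r := .n) (by decide) (m := N') (k := N'.size)
    (s := { u := unary (m + 1), v := unary n, w := unary W, t := lowDigits N' N'.size
            i := binaryNat (l + 1) }) rfl rfl
  rw [mod_two_pow_size] at e10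
  have e11 := (Prog.pop .u).does
    { u := unary (m + 1), v := unary n, w := unary W, i := binaryNat (l + 1), n := binaryNat N' }
  refine (e1.seq (e2.seq (e3.seq (e4.seq (e5.seq (e6.seq (e7.seq (e8.seq (e9.seq
    (e10.seq e11)))))))))).mono ?_
  have h1 : a.size * (25 * a + 30) ≤ a * (25 * a + 30) := Nat.mul_le_mul_right _ (size_le a)
  have h2 := size_le (l + 1)
  have h3 : (Prog.pop .u).cost = 1 := rfl
  have h4 : a * (25 * a + 33) = a * (25 * a + 30) + 3 * a := by ring
  omega

/-- The product of the sums `1 + 2 ^ (W * a (i + 1)) + ⋯ + 2 ^ (W * a (i + 1) * n)` for `i < l`. -/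
def geomProd (W n : ℕ) (a : ℕ → ℕ) : ℕ → ℕ
  | 0 => 1
  | l + 1 => geomMul (2 ^ (W * a (l + 1))) (geomProd W n a l) n

theorem geomProd_eq (W n : ℕ) (a : ℕ → ℕ) (l : ℕ) : geomProd W n a l =
    ∏ i ∈ Finset.range l, ∑ k ∈ Finset.range (n + 1), (2 ^ (W * a (i + 1))) ^ k := by
  induction l with
  | zero => rfl
  | succ l ih => rw [geomProd, geomMul_eq, ih, Finset.prod_range_succ]

theorem geomProd_mono (W n : ℕ) (a : ℕ → ℕ) : Monotone (geomProd W n a) :=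
  monotone_nat_of_le_succ fun _ => geomMul_mono _ _ (Nat.zero_le n)

/-- Each factor has `n + 1 ≤ 2 ^ n` terms, none above `2 ^ (W * G * n)`. So the bit length stays
polynomial in `n` when `G` is. -/
theorem geomProd_le {W n G : ℕ} {a : ℕ → ℕ} {l : ℕ} (ha : ∀ i < l, a (i + 1) ≤ G) :
    geomProd W n a l ≤ 2 ^ (l * (n + W * G * n)) := by
  rw [geomProd_eq, mul_comm l, pow_mul]
  refine (Finset.prod_le_pow_card _ _ (2 ^ (n + W * G * n)) ?_).trans (by simp)
  intro i hi
  refine (Finset.sum_le_card_nsmul _ _ (2 ^ (W * G * n)) ?_).trans ?_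
  · intro k hk
    rw [← pow_mul]
    gcongr
    · norm_num
    · exact ha i (Finset.mem_range.1 hi)
    · exact Nat.lt_succ_iff.1 (Finset.mem_range.1 hk)
  · rw [Finset.card_range, smul_eq_mul, pow_add]
    gcongr
    exact Nat.lt_two_pow_self

/-- From `n` (on `g`) and a machine `M` for the function `a` compute the digit number `n` of the
product of the sums `1 + q ^ a i + ⋯ + q ^ (a i * n)` for `1 ≤ i ≤ n` in the
base `q = 2 ^ (n * (n + 1))`. -/
def countMachine (M : TM) : TM :=
  toUnary.seq <| prepare.seq <| (Prog.push .n 2).tm.seq <|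
  (TM.loop Reg.u.idx 0 (factorStep M)).seq extract

theorem does_countMachine {M : TM} {a : ℕ → ℕ} {n τ G : ℕ}
    (hM : ∀ l < n, ∃ t ≤ τ, M.Computes (binaryNat (l + 1)) (binaryNat (a (l + 1))) t)
    (hG : ∀ l < n, a (l + 1) ≤ G) {W L : ℕ} (hW : n * (n + 1) = W)
    (hL : n * (n + W * G * n) + 1 = L) :
    Does (countMachine M) { g := binaryNat n }
      { io := binaryNat (geomProd W n a n / 2 ^ (W * n) % 2 ^ W) }
      (n * (25 * n + 30) + n * (n * 18 + 40) +
        n * (120 * n + τ + G * (25 * G + 33) + n * (G * (W * 18 + 18) + 120 * L + 79) + 60 * L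
          + 200 + 2) + n * (W * 16 + 18) + W * 40 + 3 * L + 6 * n + 100) := by
  have size_le : ∀ k : ℕ, k.size ≤ k := fun k => Nat.size_le.2 Nat.lt_two_pow_self
  have hsize : ∀ l ≤ n, (geomProd W n a l).size ≤ L := by
    intro l hl
    rw [Nat.size_le, ← hL]
    refine (geomProd_mono W n a hl).trans_lt ((geomProd_le hG).trans_lt ?_)
    exact Nat.pow_lt_pow_right (by norm_num) (Nat.lt_succ_self _)
  have hne : ∀ l, geomProd W n a l ≠ 0 := by
    intro l
    have := geomProd_mono W n a (Nat.zero_le l)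
    rw [geomProd] at this
    omega
  have e1 := does_toUnary (s := { g := binaryNat n }) rfl rfl rfl rfl
  have e2 := does_prepare n [] []
  rw [hW] at e2
  -- The symbol `2` is the digit one: the accumulator starts with the empty product.
  have e3 := (Prog.push .n 2).does { u := unary n, v := unary n, w := unary W }
  have e4 : Does (TM.loop Reg.u.idx 0 (factorStep M))
      { u := unary n, v := unary n, w := unary W, n := [2] }
      { v := unary n, w := unary W, i := binaryNat n, n := binaryNat (geomProd W n a n) }
      (n * (120 * n + τ + G * (25 * G + 33) + n * (G * (W * 18 + 18) + 120 * L + 79) + 60 * L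
        + 200 + 2) + 1) := by
    refine does_loop (fun l =>
      { u := unary (n - l), v := unary n, w := unary W, i := binaryNat l
        n := binaryNat (geomProd W n a l) }) n ?_ ?_ rfl ?_ ?_
    · simp [binaryNat_zero, geomProd, binaryNat_of_ne_zero one_ne_zero]
    · simp [unary]
    · intro l hl
      simp [Regs.get, headI_unary]
      omega
    · intro l hl
      obtain ⟨t, ht, hMt⟩ := hM l hl
      have h := does_factorStep n W (n - (l + 1)) (geomProd W n a l) hMt (hne l)
        (L := L) (hsize (l + 1) hl)
      rw [show n - (l + 1) + 1 = n - l by omega] at h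
      refine h.mono ?_
      have h1 := hG l hl
      have h2 : a (l + 1) * (25 * a (l + 1) + 33) ≤ G * (25 * G + 33) := by gcongr
      have h3 : n * (a (l + 1) * (W * 18 + 18) + 120 * L + 79) ≤
        n * (G * (W * 18 + 18) + 120 * L + 79) := by gcongr
      omega
  have e5 := does_extract n W (geomProd W n a n) n
  refine (e1.seq (e2.seq (e3.seq (e4.seq e5)))).mono ?_
  have h1 : n.size * (25 * n + 30) ≤ n * (25 * n + 30) := Nat.mul_le_mul_right _ (size_le n)
  have h2 := hsize n le_rfl
  have h3 := size_le n
  have h4 : (Prog.push .n 2).cost = 3 := rfl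
  omega

/-! ### Divisibility by `d` and the complete machine -/

/-- The effect of reading the digit `b` on residues modulo `d`, the residue `r` being represented
by the symbol `r + 1`. -/
def residueTable (d b : ℕ) : List (ℕ × ℕ) :=
  (List.range d).map fun r => (r + 1, (2 * r + b) % d + 1)

/-- Move the number `io` to `g`, and write its residue modulo `d` on `c`. -/
def residueMachine (d : ℕ) : TM :=
  (drain .io).seq <| (Prog.push .c 1).tm.seq <| TM.loop Reg.t.idx 0 <|
    (TM.ite Reg.t.idx 2 (TM.relabel Reg.c.idx (residueTable d 1))
      (TM.relabel Reg.c.idx (residueTable d 0))).seq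
    (Prog.seq (pushDigit .t .g) (.pop .t)).tm

theorem does_residueTable {d : ℕ} (hd : 0 < d) (b v : ℕ) {s : Regs} (hs : s.c = [v % d + 1]) :
    Does (TM.relabel Reg.c.idx (residueTable d b)) s { s with c := [(2 * v + b) % d + 1] } 1 := by
  refine does_relabel (b := v % d + 1) hs ?_ ?_
  · refine List.mem_map.2 ⟨v % d, List.mem_range.2 (Nat.mod_lt _ hd), ?_⟩
    simp [Nat.add_mod, Nat.mul_mod]
  · intro p hp h
    obtain ⟨r, hr, rfl⟩ := List.mem_map.1 hp
    obtain rfl : r = v % d := by simpa using h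
    simp [Nat.add_mod, Nat.mul_mod]

/-- The residue is a single symbol updated by table lookup, so a digit costs a bounded number of
steps, with a bound independent of `d`. -/
theorem does_residueMachine {d : ℕ} (hd : 0 < d) (n : ℕ) :
    Does (residueMachine d) { io := binaryNat n } { g := binaryNat n, c := [n % d + 1] }
      (20 * n.size + 10) := by
  have e1 := does_drain (r := .io) (by decide) (s := { io := binaryNat n }) (m := n) rfl rfl
  have e2 := (Prog.push .c 1).does { t := lowDigits n n.size }
  have e3 : Does (TM.loop Reg.t.idx 0 <|
      (TM.ite Reg.t.idx 2 (TM.relabel Reg.c.idx (residueTable d 1))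
        (TM.relabel Reg.c.idx (residueTable d 0))).seq
      (Prog.seq (pushDigit .t .g) (.pop .t)).tm)
      { t := lowDigits n n.size, c := [1] } { g := binaryNat n, c := [n % d + 1] }
      (n.size * (1 + 1 + 7 + 1 + 2) + 1) := by
    refine does_horner (m := n) (M := n) (v := 0) (k := n.size)
      (fun v w => { g := binaryNat v, c := [v % d + 1], t := w }) ?_ ?_ (fun _ _ => rfl) ?_ ?_
    · simp [binaryNat_zero]
    · simp [mod_two_pow_size]
    · intro v j _
      have h : Does (TM.ite Reg.t.idx 2 (TM.relabel Reg.c.idx (residueTable d 1))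
          (TM.relabel Reg.c.idx (residueTable d 0)))
          { g := binaryNat v, c := [v % d + 1], t := lowDigits n (j + 1) }
          { g := binaryNat v, c := [(2 * v + n / 2 ^ j % 2) % d + 1]
            t := lowDigits n (j + 1) } (1 + 1) := by
        have h2 : n / 2 ^ j % 2 = 0 ∨ n / 2 ^ j % 2 = 1 := by omega
        rcases h2 with h2 | h2
        · rw [h2]
          refine Does.ite_neg (does_residueTable hd 0 v rfl) ?_
          simp [Regs.get, lowDigits, h2]
        · rw [h2]
          refine Does.ite_pos (does_residueTable hd 1 v rfl) ?_
          simp [Regs.get, lowDigits, h2]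
      refine h.seq (Prog.does' ?_)
      rw [Prog.exec, exec_pushDigit (v := v) (m := n / 2 ^ j) (w := lowDigits n j) rfl rfl]
      simp [Prog.exec, Regs.set, Regs.get, lowDigits]
    · simp [mod_two_pow_size]
  refine (e1.seq (e2.seq e3)).mono ?_
  have h4 : (Prog.push .c 1).cost = 3 := rfl
  omega

/-- If `d` divides the input, apply `countMachine M`, otherwise give the answer `0`. -/
def partitionMachine (M : TM) (d : ℕ) : TM :=
  (residueMachine d).seq <| TM.ite Reg.c.idx 1 ((Prog.pop .c).tm.seq (countMachine M))
    ((Prog.pop .c).tm.seq (clear .g))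

theorem does_partitionMachine_of_dvd {M : TM} {d n t : ℕ} {s : Regs} (hd : 0 < d) (h : d ∣ n)
    (hM : Does (countMachine M) { g := binaryNat n } s t) :
    Does (partitionMachine M d) { io := binaryNat n } s (20 * n.size + t + 20) := by
  have h1 := does_residueMachine hd n
  rw [Nat.mod_eq_zero_of_dvd h] at h1
  have h2 := (((Prog.pop .c).does { g := binaryNat n, c := [1] }).seq hM)
  refine (h1.seq (h2.ite_pos rfl)).mono ?_
  have h4 : (Prog.pop .c).cost = 1 := rfl
  omega

/-- The time has to be of order `log n` rather than polynomial in `n`, because the output `0`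
contributes nothing to `m_f(n)` beyond a constant. -/
theorem does_partitionMachine_of_not_dvd (M : TM) {d n : ℕ} (hd : 0 < d) (h : ¬d ∣ n) :
    Does (partitionMachine M d) { io := binaryNat n } { io := binaryNat 0 }
      (23 * n.size + 20) := by
  have h1 := does_residueMachine hd n
  have h2 := ((Prog.pop .c).does { g := binaryNat n, c := [n % d + 1] }).seq
    (does_clear_binaryNat (r := .g) (s := { g := binaryNat n }) rfl)
  have h3 := h1.seq (h2.ite_neg (r := .c) (b := 1)
    (A := (Prog.pop .c).tm.seq (countMachine M)) ?_)
  · rw [binaryNat_zero]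
    refine h3.mono ?_
    have h4 : (Prog.pop .c).cost = 1 := rfl
    omega
  · simpa [Regs.get, Nat.dvd_iff_mod_eq_zero] using h

/-- `d` enters only through the two residue tables and `M` only through `shift`; every other piece
is a constant table. -/
theorem primrec_partitionMachine :
    Primrec fun p : TM × ℕ × List ℕ => partitionMachine p.1 p.2.1 := by
  have ht : ∀ b, Primrec fun p : TM × ℕ × List ℕ => residueTable p.2.1 b := by
    intro b
    refine Primrec.list_map (Primrec.list_range.comp (Primrec.fst.comp Primrec.snd)) ?_
    unfold Primrec₂
    have h1 : Primrec fun p : (TM × ℕ × List ℕ) × ℕ => p.2 := Primrec.snd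
    have h2 : Primrec fun p : (TM × ℕ × List ℕ) × ℕ => p.1.2.1 :=
      Primrec.fst.comp (Primrec.snd.comp Primrec.fst)
    exact (Primrec.succ.comp h1).pair (Primrec.succ.comp (Primrec.nat_mod.comp
      (Primrec.nat_add.comp (Primrec.nat_mul.comp (Primrec.const 2) h1) (Primrec.const b)) h2))
  refine TM.primrec_seq (TM.primrec_seq (Primrec.const _) (TM.primrec_seq (Primrec.const _)
    (TM.primrec_loop _ _ (TM.primrec_seq (TM.primrec_ite _ _ (TM.primrec_relabel _ (ht 1))
      (TM.primrec_relabel _ (ht 0))) (Primrec.const _)))))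
    (TM.primrec_ite _ _ (TM.primrec_seq (Primrec.const _) ?_) (Primrec.const _))
  refine TM.primrec_seq (Primrec.const _) (TM.primrec_seq (Primrec.const _)
    (TM.primrec_seq (Primrec.const _) (TM.primrec_seq (TM.primrec_loop _ _ ?_)
      (Primrec.const _))))
  refine TM.primrec_seq (Primrec.const _) (TM.primrec_seq ?_ (Primrec.const _))
  exact TM.primrec_shift _ Primrec.fst

/-! ### Partitions with parts in a set -/

section GeneratingFunction
open PowerSeries

theorem summable_X_pow_mul {m : ℕ} (hm : m ≠ 0) :
    Summable fun j : ℕ => (X ^ (m * j) : ℚ⟦X⟧) := by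
  simp_rw [pow_mul]
  exact PowerSeries.WithPiTopology.summable_pow_of_constantCoeff_eq_zero (by simp [hm])

theorem tsum_X_pow_mul {m : ℕ} (hm : m ≠ 0) :
    ∑' j : ℕ, (X ^ (m * j) : ℚ⟦X⟧) = (1 - X ^ m)⁻¹ := by
  rw [PowerSeries.eq_inv_iff_mul_eq_one (by simp [hm])]
  have h := summable_X_pow_mul hm
  simp_rw [pow_mul] at h ⊢
  exact Summable.tsum_pow_mul_one_sub h

theorem one_add_tsum_X_pow_mul {m : ℕ} (hm : m ≠ 0) :
    1 + ∑' j : ℕ+, (X ^ (m * (j : ℕ)) : ℚ⟦X⟧) = ∑' j : ℕ, (X ^ (m * j) : ℚ⟦X⟧) := by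
  have h := tsum_pnat_eq_tsum_succ (f := fun j : ℕ => (X ^ (m * j) : ℚ⟦X⟧))
  rw [h, (summable_X_pow_mul hm).tsum_eq_zero_add]
  simp

theorem hasProd_numPartitions {g : ℕ+ → ℕ+} (hg : Function.Injective g) :
    HasProd (fun i : ℕ+ => ((1 - X ^ (g i : ℕ))⁻¹ : ℚ⟦X⟧))
      (PowerSeries.mk fun n => (numPartitions (valueSet g) n : ℚ)) := by
  classical
  have h := Nat.Partition.hasProd_powerSeriesMk_card_restricted (R := ℚ) (· ∈ valueSet g)
  have hinj : Function.Injective fun m : ℕ+ => (g m).natPred :=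
    PNat.natPred_injective.comp hg
  -- The general product runs over all positive integers with factor `1` off `A`, so it may be
  -- reindexed along the injective `g`.
  rw [← hinj.hasProd_iff] at h
  · have h1 : ((fun i => if i + 1 ∈ valueSet g then ∑' j : ℕ, (X : ℚ⟦X⟧) ^ ((i + 1) * j) else 1) ∘
        fun m : ℕ+ => (g m).natPred) = fun i : ℕ+ => ((1 - X ^ (g i : ℕ))⁻¹ : ℚ⟦X⟧) := by
      funext m
      have h1 : (g m).natPred + 1 = (g m : ℕ) := PNat.natPred_add_one _
      simp only [Function.comp_apply, h1]
      rw [if_pos ⟨m, rfl⟩, tsum_X_pow_mul (PNat.ne_zero _)]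
    have h2 : (PowerSeries.mk fun n => (numPartitions (valueSet g) n : ℚ)) = PowerSeries.mk
        fun n => ((Nat.Partition.restricted n (· ∈ valueSet g)).card : ℚ) := by
      congr 1
    rw [h2, ← h1]
    exact h
  · intro x hx
    rw [if_neg]
    rintro ⟨m, hm⟩
    refine hx ⟨m, ?_⟩
    simp only at hm
    simp [PNat.natPred, hm]

/-- The polynomial of the partitions into at most `n` copies of each of the parts
`a 1`, …, `a l`. -/
noncomputable def boundedPartitionPoly (n : ℕ) (a : ℕ → ℕ) (l : ℕ) : Polynomial ℕ :=
  ∏ i ∈ Finset.range l, ∑ k ∈ Finset.range (n + 1), Polynomial.X ^ (a (i + 1) * k)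

/-- Modulo `X ^ (n + 1)` the series `1 / (1 - X ^ m)` equals its truncation, and equals `1` if `m >
n`. Since `g i ≥ i`, all partial products containing the first `n` factors have the same coefficient
at `n`, which is then the coefficient of the limit. -/
theorem coeff_boundedPartitionPoly {g : ℕ+ → ℕ+} (hg : StrictMono g) (n : ℕ) :
    (boundedPartitionPoly n (fun l => g (l - 1).succPNat) n).coeff n
      = numPartitions (valueSet g) n := by
  set I : Ideal ℚ⟦X⟧ := Ideal.span {X ^ (n + 1)} with hI
  set φ := Ideal.Quotient.mk I with hφ
  have hφX : ∀ k, n < k → φ (X ^ k) = 0 := by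
    intro k hk
    rw [hφ, Ideal.Quotient.eq_zero_iff_mem, hI, Ideal.mem_span_singleton]
    exact pow_dvd_pow _ hk
  have hcoeff : ∀ p q : ℚ⟦X⟧, φ p = φ q → coeff n p = coeff n q := by
    intro p q h
    rw [hφ, Ideal.Quotient.eq, hI, Ideal.mem_span_singleton, PowerSeries.X_pow_dvd_iff] at h
    have := h n (Nat.lt_succ_self n)
    rwa [map_sub, sub_eq_zero] at this
  have hgeom : ∀ m : ℕ, m ≠ 0 →
      φ ((1 - X ^ m)⁻¹) = φ (∑ k ∈ Finset.range (n + 1), X ^ (m * k)) := by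
    intro m hm
    have h1 : ((1 - X ^ m)⁻¹ : ℚ⟦X⟧) * (1 - X ^ m) = 1 :=
      PowerSeries.inv_mul_cancel _ (by simp [hm])
    have h2 : (1 - X ^ m) * ∑ k ∈ Finset.range (n + 1), (X : ℚ⟦X⟧) ^ (m * k) =
        1 - X ^ (m * (n + 1)) := by
      simp_rw [pow_mul]
      exact mul_neg_geom_sum _ _
    have h3 : n < m * (n + 1) := Nat.lt_of_lt_of_le (Nat.lt_succ_self n)
      (Nat.le_mul_of_pos_left _ (Nat.pos_of_ne_zero hm))
    calc φ ((1 - X ^ m)⁻¹) = φ ((1 - X ^ m)⁻¹) * φ (1 - X ^ (m * (n + 1))) := by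
          rw [map_sub, hφX _ h3]; simp
      _ = φ (∑ k ∈ Finset.range (n + 1), X ^ (m * k)) := by
          rw [← map_mul, ← h2, ← mul_assoc, h1, one_mul]
  have hlarge : ∀ m : ℕ, n < m → φ ((1 - X ^ m)⁻¹) = 1 := by
    intro m hm
    rw [hgeom m (by omega), map_sum, Finset.sum_eq_single 0]
    · simp
    · intro k _ hk
      exact hφX _ (hm.trans_le (Nat.le_mul_of_pos_right _ (Nat.pos_of_ne_zero hk)))
    · simp
  have hlim := (PowerSeries.WithPiTopology.tendsto_iff_coeff_tendsto ℚ _ _ _).1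
    (hasProd_numPartitions hg.injective) n
  rw [SummationFilter.unconditional_filter] at hlim
  have hinj : Function.Injective Nat.succPNat := Nat.succPNat_injective
  have hprod : ∀ s : Finset ℕ+, (Finset.range n).map ⟨_, hinj⟩ ≤ s →
      coeff n (∏ i ∈ s, (1 - X ^ (g i : ℕ) : ℚ⟦X⟧)⁻¹) =
        ((boundedPartitionPoly n (fun l => g (l - 1).succPNat) n).coeff n : ℚ) := by
    intro s hs
    have h1 : ((boundedPartitionPoly n (fun l => g (l - 1).succPNat) n).coeff n : ℚ) =
        coeff n (∏ i ∈ Finset.range n, ∑ k ∈ Finset.range (n + 1),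
          (X : ℚ⟦X⟧) ^ ((g i.succPNat : ℕ) * k)) := by
      have : (∏ i ∈ Finset.range n, ∑ k ∈ Finset.range (n + 1),
          (X : ℚ⟦X⟧) ^ ((g i.succPNat : ℕ) * k)) =
          Polynomial.coeToPowerSeries.ringHom
            ((boundedPartitionPoly n (fun l => g (l - 1).succPNat) n).map (Nat.castRingHom ℚ)) := by
        simp [boundedPartitionPoly, Polynomial.map_prod, Polynomial.map_sum, map_prod, map_sum]
      rw [this]
      simp
    rw [h1]
    apply hcoeff
    rw [map_prod, map_prod, ← Finset.prod_subset hs, Finset.prod_map]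
    · exact Finset.prod_congr rfl fun i _ => hgeom _ (PNat.ne_zero _)
    · intro i _ hi
      apply hlarge
      have h2 : n < (i : ℕ) := by
        by_contra h
        refine hi (Finset.mem_map.2 ⟨i.natPred, ?_, PNat.succPNat_natPred i⟩)
        have := i.pos
        simp [PNat.natPred]
        omega
      exact h2.trans_le (PNat.coe_le_coe _ _ |>.2 (hg.le_apply (x := i)))
  have hconst := tendsto_atTop_of_eventually_const (u := fun s : Finset ℕ+ =>
    coeff n (∏ i ∈ s, (1 - X ^ (g i : ℕ) : ℚ⟦X⟧)⁻¹)) hprod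
  have := tendsto_nhds_unique hconst hlim
  rw [coeff_mk] at this
  exact_mod_cast this

end GeneratingFunction

/-! ### Kronecker substitution: coefficients as digits -/

theorem eval_div_pow_mod {B : ℕ} (p : Polynomial ℕ) (hp : ∀ k, p.coeff k < B) (n : ℕ) :
    p.eval B / B ^ n % B = p.coeff n := by
  have hB : 0 < B := (Nat.zero_le _).trans_lt (hp 0)
  have h : ∀ p : Polynomial ℕ, p.eval B = p.divX.eval B * B + p.coeff 0 := by
    intro p
    conv_lhs => rw [← p.divX_mul_X_add]
    simp
  induction n generalizing p with
  | zero => rw [h p]; simp [Nat.mod_eq_of_lt (hp 0)]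
  | succ n ih =>
    rw [pow_succ', ← Nat.div_div_eq_div_mul, h p, add_comm, Nat.add_mul_div_right _ _ hB,
      Nat.div_eq_of_lt (hp 0), zero_add, ih _ (fun k => by rw [Polynomial.coeff_divX]; exact hp _),
      Polynomial.coeff_divX]

theorem coeff_le_eval_one (p : Polynomial ℕ) (k : ℕ) : p.coeff k ≤ p.eval 1 := by
  rw [Polynomial.eval_eq_sum, Polynomial.sum]
  by_cases h : k ∈ p.support
  · simpa using Finset.single_le_sum (f := fun e => p.coeff e * 1 ^ e) (fun _ _ => Nat.zero_le _) h
  · rw [Polynomial.notMem_support_iff.1 h]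
    exact Nat.zero_le _

/-- No coefficient exceeds the value at `1`, which is `(n + 1) ^ n < (2 ^ (n + 1)) ^ n = 2 ^ W`;
this is the reason for the choice of `W`. -/
theorem digit_geomProd {g : ℕ+ → ℕ+} (hg : StrictMono g) {n W : ℕ} (hn : n ≠ 0)
    (hW : n * (n + 1) = W) :
    geomProd W n (fun l => g (l - 1).succPNat) n / 2 ^ (W * n) % 2 ^ W
      = numPartitions (valueSet g) n := by
  have h1 : geomProd W n (fun l => g (l - 1).succPNat) n =
      (boundedPartitionPoly n (fun l => g (l - 1).succPNat) n).eval (2 ^ W) := by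
    simp [geomProd_eq, boundedPartitionPoly, Polynomial.eval_prod, Polynomial.eval_finsetSum,
      ← pow_mul, mul_assoc]
  rw [h1, pow_mul, eval_div_pow_mod, coeff_boundedPartitionPoly hg]
  intro k
  refine (coeff_le_eval_one _ k).trans_lt ?_
  have h2 : (boundedPartitionPoly n (fun l => g (l - 1).succPNat) n).eval 1 = (n + 1) ^ n := by
    simp [boundedPartitionPoly, Polynomial.eval_prod, Polynomial.eval_finsetSum]
  rw [h2, ← hW, mul_comm, pow_mul]
  exact Nat.pow_lt_pow_left Nat.lt_two_pow_self hn

/-! ### The growth of the number of partitions -/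

theorem pos_of_isGcdOf {g : ℕ+ → ℕ+} {d : ℕ} (hd : IsGcdOf d (valueSet g)) : 0 < d := by
  refine Nat.pos_of_ne_zero ?_
  rintro rfl
  have := (hd 0).1 dvd_rfl (g 1) ⟨1, rfl⟩
  exact PNat.ne_zero _ (zero_dvd_iff.1 this)

theorem numPartitions_eq_zero {A : Set ℕ} {d n : ℕ} (hd : IsGcdOf d A) (h : ¬d ∣ n) :
    numPartitions A n = 0 := by
  classical
  rw [numPartitions, Finset.card_eq_zero, Finset.eq_empty_iff_forall_notMem]
  intro p hp
  refine h (p.parts_sum ▸ Multiset.dvd_sum fun a ha => ?_)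
  exact (hd d).1 dvd_rfl a ((Finset.mem_filter_univ p).1 hp a ha)

/-- Subsets of the first `k` elements of `A`, less a fixed finite set `t`, extend to different
partitions of `n`; the factor `2 ^ b` pays for the elements of `t`. -/
theorem exists_two_pow_le_numPartitions {g : ℕ+ → ℕ+} (hg : StrictMono g) {D d : ℕ}
    (hD : ∀ n : ℕ+, (g n : ℕ) < (1 + (n : ℕ)) ^ D) (hd : IsGcdOf d (valueSet g)) :
    ∃ N b : ℕ, ∀ n ≥ N, d ∣ n → ∀ k : ℕ, 2 * (k * (1 + k) ^ D) ≤ n →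
      2 ^ k ≤ 2 ^ b * numPartitions (valueSet g) n := by
  classical
  have hgcd : Nat.setGcd (valueSet g) = d := Nat.dvd_antisymm
    ((hd _).2 fun a ha => Nat.setGcd_dvd_of_mem ha) (Nat.dvd_setGcd_iff.2 ((hd d).1 dvd_rfl))
  obtain ⟨t, n₀, htA, ht⟩ := Nat.exists_mem_span_nat_finset_of_ge (valueSet g)
  rw [hgcd] at ht
  -- The sum of `S` will be at most `n / 2`, so the remainder is at least `n / 2 ≥ n₀` and can be
  -- composed of elements of `t`.
  refine ⟨2 * n₀, t.card, fun n hn hdn k hk => ?_⟩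
  have hinj : Function.Injective fun l : ℕ => (g l.succPNat : ℕ) := fun a b h =>
    Nat.succPNat_injective (hg.injective (PNat.coe_injective h))
  set T := ((Finset.range k).image fun l => (g l.succPNat : ℕ)) \ t with hT
  have hTk : ∀ a ∈ T, a ≤ (1 + k) ^ D := by
    intro a ha
    obtain ⟨l, hl, rfl⟩ := Finset.mem_image.1 (Finset.mem_sdiff.1 ha).1
    refine (hD _).le.trans (Nat.pow_le_pow_left ?_ D)
    have := Finset.mem_range.1 hl
    rw [Nat.succPNat_coe]
    omega
  have hTA : ∀ a ∈ T, a ∈ valueSet g := by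
    intro a ha
    obtain ⟨l, hl, rfl⟩ := Finset.mem_image.1 (Finset.mem_sdiff.1 ha).1
    exact ⟨_, rfl⟩
  have hTcard : T.card ≤ k := by
    refine (Finset.card_le_card Finset.sdiff_subset).trans ?_
    exact Finset.card_image_le.trans (by simp)
  have hkT : k ≤ t.card + T.card := by
    have h1 := Finset.le_card_sdiff t ((Finset.range k).image fun l => (g l.succPNat : ℕ))
    rw [Finset.card_image_of_injective _ hinj, Finset.card_range, ← hT] at h1
    omega
  -- The parts outside `t` are exactly the elements of `S`, which makes the assignment of a
  -- partition to `S` injective.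
  have key : ∀ S ∈ T.powerset, ∃ p : n.Partition, (∀ a ∈ p.parts, a ∈ valueSet g) ∧
      p.parts.filter (· ∉ t) = S.val := by
    intro S hS
    rw [Finset.mem_powerset] at hS
    have hsum : ∑ a ∈ S, a ≤ k * (1 + k) ^ D := by
      refine (Finset.sum_le_card_nsmul _ _ _ fun a ha => hTk a (hS ha)).trans ?_
      rw [smul_eq_mul]
      exact Nat.mul_le_mul_right _ ((Finset.card_le_card hS).trans hTcard)
    have hdS : d ∣ ∑ a ∈ S, a := Finset.dvd_sum fun a ha => (hd d).1 dvd_rfl a (hTA a (hS ha))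
    have hmem := ht (n - ∑ a ∈ S, a) (by omega) (Nat.dvd_sub hdn hdS)
    obtain ⟨f, -, hf⟩ := Submodule.mem_span_finset.1 hmem
    have hmul : ∀ a ∈ ∑ b ∈ t, f b • ({b} : Multiset ℕ), a ∈ t := by
      intro a ha
      obtain ⟨b, hb, hab⟩ := Multiset.mem_sum.1 ha
      have := Multiset.mem_of_mem_nsmul hab
      rw [Multiset.mem_singleton] at this
      exact this ▸ hb
    have hA : ∀ a ∈ S.val + ∑ b ∈ t, f b • ({b} : Multiset ℕ), a ∈ valueSet g := by
      intro a ha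
      rcases Multiset.mem_add.1 ha with h | h
      · exact hTA a (hS h)
      · exact htA (hmul a h)
    refine ⟨⟨S.val + ∑ b ∈ t, f b • ({b} : Multiset ℕ), ?_, ?_⟩, hA, ?_⟩
    · intro a ha
      obtain ⟨m, rfl⟩ := hA a ha
      exact PNat.pos _
    · have h1 : (∑ b ∈ t, f b • ({b} : Multiset ℕ)).sum = n - ∑ a ∈ S, a := by
        rw [← hf, Multiset.sum_sum]
        simp [Multiset.sum_nsmul]
      have h2 : S.val.sum = ∑ a ∈ S, a := Finset.sum_val S
      rw [Multiset.sum_add, h1, h2]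
      omega
    · rw [Multiset.filter_add, Multiset.filter_eq_self.2, Multiset.filter_eq_nil.2, add_zero]
      · exact fun a ha => not_not.2 (hmul a ha)
      · exact fun a ha => (Finset.mem_sdiff.1 (hS ha)).2
  choose! P hPA hPS using key
  have hle : 2 ^ T.card ≤ numPartitions (valueSet g) n := by
    rw [← Finset.card_powerset, numPartitions]
    refine Finset.card_le_card_of_injOn P ?_ ?_
    · intro S hS
      exact Finset.mem_filter.2 ⟨Finset.mem_univ _, hPA S hS⟩
    · intro S hS S' hS' h
      apply Finset.val_injective
      rw [← hPS S hS, ← hPS S' hS', h]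
  calc 2 ^ k ≤ 2 ^ (t.card + T.card) := Nat.pow_le_pow_right (by norm_num) hkT
    _ = 2 ^ t.card * 2 ^ T.card := pow_add _ _ _
    _ ≤ _ := Nat.mul_le_mul_left _ hle

/-! ### Comparison of `pioSize` with the input -/

theorem one_le_pioSize (f : ℕ+ → ℤ) (n : ℕ+) : 1 ≤ pioSize f n := by
  have h1 : Real.log 2 ≤ Real.log (1 + ((n : ℕ) : ℝ)) := by
    apply Real.log_le_log (by norm_num)
    have : (1 : ℝ) ≤ (n : ℕ) := by exact_mod_cast n.pos
    linarith
  have h2 : Real.log 2 ≤ Real.log (2 + |(f n : ℝ)|) :=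
    Real.log_le_log (by norm_num) (by linarith [abs_nonneg (f n : ℝ)])
  have := Real.log_two_gt_d9
  rw [pioSize]
  linarith

/-- The length is at most `1 + log (1 + n) / log 2`, where `1 ≤ m_f(n)` and `1 / log 2 < 2`. -/
theorem size_le_pioSize (f : ℕ+ → ℤ) (n : ℕ+) : (((n : ℕ).size : ℕ) : ℝ) ≤ 3 * pioSize f n := by
  have h1 : 2 ^ ((n : ℕ).size - 1) ≤ (n : ℕ) := by
    rw [← Nat.lt_size]
    have := Nat.size_pos.2 n.pos
    omega
  have h2 : (((n : ℕ).size - 1 : ℕ) : ℝ) * Real.log 2 ≤ Real.log (1 + ((n : ℕ) : ℝ)) := by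
    rw [← Real.log_pow]
    apply Real.log_le_log (by positivity)
    have : ((2 ^ ((n : ℕ).size - 1) : ℕ) : ℝ) ≤ ((n : ℕ) : ℝ) := by exact_mod_cast h1
    push_cast at this
    linarith
  have h3 : 0 ≤ Real.log (2 + |(f n : ℝ)|) :=
    Real.log_nonneg (by linarith [abs_nonneg (f n : ℝ)])
  have h4 := Real.log_two_gt_d9
  have h5 := one_le_pioSize f n
  have h6 : (((n : ℕ).size : ℕ) : ℝ) ≤ (((n : ℕ).size - 1 : ℕ) : ℝ) + 1 := by
    exact_mod_cast (by omega : (n : ℕ).size ≤ (n : ℕ).size - 1 + 1)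
  have h7 : (0 : ℝ) ≤ (((n : ℕ).size - 1 : ℕ) : ℝ) := Nat.cast_nonneg _
  rw [pioSize] at h5 ⊢
  nlinarith

theorem one_add_le_pioSize_pow {g : ℕ+ → ℕ+} (hg : StrictMono g) {D d : ℕ}
    (hD : ∀ n : ℕ+, (g n : ℕ) < (1 + (n : ℕ)) ^ D) (hd : IsGcdOf d (valueSet g)) :
    ∃ C : ℕ, ∀ n : ℕ+, d ∣ n → (1 + ((n : ℕ) : ℝ)) ≤
      C * pioSize (fun n => (numPartitions (valueSet g) n : ℤ)) n ^ (D + 1) := by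
  obtain ⟨N, b, h⟩ := exists_two_pow_le_numPartitions hg hD hd
  -- The summand `N` serves the small `n`, the other one those to which the lower bound for the
  -- number of partitions applies.
  refine ⟨2 * (4 + b) ^ (D + 1) + N, fun n hdn => ?_⟩
  have hs := one_le_pioSize (fun n => (numPartitions (valueSet g) n : ℤ)) n
  set s := pioSize (fun n => (numPartitions (valueSet g) n : ℤ)) n with hsdef
  have hs1 : 1 ≤ s ^ (D + 1) := one_le_pow₀ hs
  push_cast
  rw [add_mul]
  by_cases hn : (n : ℕ) < N
  · have h1 : (1 + ((n : ℕ) : ℝ)) ≤ N := by exact_mod_cast (by omega : 1 + (n : ℕ) ≤ N)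
    have h2 : (N : ℝ) ≤ N * s ^ (D + 1) := le_mul_of_one_le_right (Nat.cast_nonneg _) hs1
    have h3 : 0 ≤ 2 * (4 + (b : ℝ)) ^ (D + 1) * s ^ (D + 1) := by positivity
    linarith
  · have hex : ∃ k, (n : ℕ) < 2 * (2 + k) ^ (D + 1) :=
      ⟨n, by
        have := Nat.le_self_pow (show D + 1 ≠ 0 by omega) (2 + (n : ℕ))
        omega⟩
    -- Take the least `k` with `n < 2 * (2 + k) ^ (D + 1)`. If `k > 0`, minimality gives `n ≥ 2 * (1
    -- + k) ^ (D + 1)`, which is more than needed.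
    obtain ⟨k, hk1, hk2⟩ : ∃ k, (n : ℕ) < 2 * (2 + k) ^ (D + 1) ∧
        2 * (k * (1 + k) ^ D) ≤ n := by
      obtain ⟨k, hk, hmin⟩ : ∃ k, (n : ℕ) < 2 * (2 + k) ^ (D + 1) ∧
          ∀ j < k, ¬(n : ℕ) < 2 * (2 + j) ^ (D + 1) :=
        ⟨Nat.find hex, Nat.find_spec hex, fun _ => Nat.find_min hex⟩
      refine ⟨k, hk, ?_⟩
      rcases k with _ | j
      · simp
      · have := not_lt.1 (hmin j j.lt_succ_self)
        refine le_trans ?_ this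
        rw [pow_succ', show 1 + (j + 1) = 2 + j by omega]
        exact Nat.mul_le_mul_left _ (Nat.mul_le_mul_right _ (by omega))
    have hp := h n (not_lt.1 hn) hdn k hk2
    set p := numPartitions (valueSet g) n with hpdef
    have hp' : ((2 : ℝ) ^ k) ≤ 2 ^ b * p := by exact_mod_cast hp
    have hp0 : (0 : ℝ) < p := by
      rcases Nat.eq_zero_or_pos p with h0 | h0
      · rw [h0] at hp
        simp at hp
      · exact_mod_cast h0
    have hlog := Real.log_le_log (by positivity) hp'
    rw [Real.log_mul (by positivity) hp0.ne', Real.log_pow, Real.log_pow] at hlog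
    have hps : Real.log p ≤ s := by
      have h1 : Real.log p ≤ Real.log (2 + |(((p : ℤ)) : ℝ)|) := by
        apply Real.log_le_log hp0
        rw [Int.cast_natCast, abs_of_pos hp0]
        linarith
      have h2 : 0 ≤ Real.log (1 + ((n : ℕ) : ℝ)) :=
        Real.log_nonneg (by linarith [Nat.cast_nonneg (α := ℝ) (n : ℕ)])
      rw [hsdef, pioSize]
      linarith
    have hl2 := Real.log_two_gt_d9
    -- This is `k * log 2 ≤ b * log 2 + s` together with `log 2 > 1 / 2`.
    have hkb : (k : ℝ) ≤ b + 2 * s := by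
      by_contra hcon
      push Not at hcon
      nlinarith
    have h1 : (1 + ((n : ℕ) : ℝ)) ≤ 2 * (2 + k) ^ (D + 1) := by
      exact_mod_cast (by omega : 1 + (n : ℕ) ≤ 2 * (2 + k) ^ (D + 1))
    have h2 : (2 + (k : ℝ)) ≤ (4 + b) * s := by
      have : (0 : ℝ) ≤ b := Nat.cast_nonneg _
      nlinarith
    have h3 : (2 + (k : ℝ)) ^ (D + 1) ≤ ((4 + b) * s) ^ (D + 1) := by gcongr
    rw [mul_pow] at h3
    have h4 : 0 ≤ (N : ℝ) * s ^ (D + 1) := by positivity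
    linarith

/-! ### Polynomial bounds -/

/-- The function `T` is bounded by a polynomial. -/
def PolyBounded (T : ℕ → ℕ) : Prop := ∃ c e : ℕ, ∀ n, T n ≤ c * (1 + n) ^ e

namespace PolyBounded
variable {S T : ℕ → ℕ}

theorem const (k : ℕ) : PolyBounded fun _ => k := ⟨k, 0, fun n => by simp⟩

theorem id : PolyBounded fun n => n := ⟨1, 1, fun n => by simp⟩

theorem add (hS : PolyBounded S) (hT : PolyBounded T) : PolyBounded fun n => S n + T n := by
  obtain ⟨c, e, h⟩ := hS
  obtain ⟨c', e', h'⟩ := hT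
  refine ⟨c + c', e + e', fun n => (add_le_add (h n) (h' n)).trans ?_⟩
  rw [add_mul]
  gcongr <;> omega

theorem mul (hS : PolyBounded S) (hT : PolyBounded T) : PolyBounded fun n => S n * T n := by
  obtain ⟨c, e, h⟩ := hS
  obtain ⟨c', e', h'⟩ := hT
  refine ⟨c * c', e + e', fun n => (Nat.mul_le_mul (h n) (h' n)).trans_eq ?_⟩
  rw [pow_add]
  ring

theorem pow (hT : PolyBounded T) (k : ℕ) : PolyBounded fun n => T n ^ k := by
  induction k with
  | zero => exact const 1
  | succ k ih => exact ih.mul hT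

end PolyBounded

/-! ### Running time of the partition machine -/

theorem exists_time_countMachine {M : TM} {g : ℕ+ → ℕ+} (hg : StrictMono g) {D : ℕ}
    (hD : ∀ n : ℕ+, (g n : ℕ) < (1 + (n : ℕ)) ^ D) (hM : ComputesInPolySteps M g) :
    ∃ T : ℕ → ℕ, PolyBounded T ∧ ∀ n : ℕ+, Does (countMachine M) { g := binaryNat n }
      { io := binaryNat (numPartitions (valueSet g) n) } (T n) := by
  obtain ⟨c, e, hM⟩ := hM
  refine ⟨fun n => n * (25 * n + 30) + n * (n * 18 + 40) + n * (120 * n + c * (1 + n) ^ e +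
    (1 + n) ^ D * (25 * (1 + n) ^ D + 33) + n * ((1 + n) ^ D * (n * (n + 1) * 18 + 18) +
    120 * (n * (n + n * (n + 1) * (1 + n) ^ D * n) + 1) + 79) +
    60 * (n * (n + n * (n + 1) * (1 + n) ^ D * n) + 1) + 200 + 2) + n * (n * (n + 1) * 16 + 18) +
    n * (n + 1) * 40 + 3 * (n * (n + n * (n + 1) * (1 + n) ^ D * n) + 1) + 6 * n + 100,
    ?_, fun n => (does_countMachine (n := n) (a := fun l => g (l - 1).succPNat)
    (τ := c * (1 + n) ^ e) (G := (1 + n) ^ D) ?_ ?_ rfl rfl).congr_right ?_⟩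
  · have h1 := PolyBounded.id
    have hk := PolyBounded.const
    repeat' first | exact h1 | exact hk _ | apply PolyBounded.add | apply PolyBounded.mul |
      apply PolyBounded.pow
  · intro l hl
    obtain ⟨t, h1, h2⟩ := hM l.succPNat
    refine ⟨t, h2.trans ?_, h1⟩
    rw [Nat.succPNat_coe]
    gcongr
    omega
  · intro l hl
    refine (hD _).le.trans (Nat.pow_le_pow_left ?_ D)
    rw [Nat.add_sub_cancel, Nat.succPNat_coe]
    omega
  · rw [digit_geomProd hg n.ne_zero rfl]

theorem binaryInt_natCast (n : ℕ) : binaryInt n = binaryNat n := by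
  simp [binaryInt]

theorem isPIOAlgorithm_partitionMachine {M : TM} {g : ℕ+ → ℕ+} (hg : StrictMono g) {D d : ℕ}
    (hD : ∀ n : ℕ+, (g n : ℕ) < (1 + (n : ℕ)) ^ D) (hM : ComputesInPolySteps M g)
    (hd : IsGcdOf d (valueSet g)) :
    IsPIOAlgorithm (partitionMachine M d) (fun n => (numPartitions (valueSet g) n : ℤ)) := by
  have hd0 := pos_of_isGcdOf hd
  obtain ⟨T, ⟨c, e, hT⟩, hcount⟩ := exists_time_countMachine hg hD hM
  obtain ⟨C, hC⟩ := one_add_le_pioSize_pow hg hD hd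
  -- The number `100` covers the terms linear in the input length (at most `23 * 3 + 20`), and `c *
  -- C ^ e` the counting. The `+ 1` in the exponent makes the power at least `s` even if `e = 0`.
  refine ⟨100 + c * C ^ e, (D + 1) * e + 1, fun n => ?_⟩
  have hs := one_le_pioSize (fun n => (numPartitions (valueSet g) n : ℤ)) n
  have hsize := size_le_pioSize (fun n => (numPartitions (valueSet g) n : ℤ)) n
  specialize hC n
  simp only [binaryInt_natCast]
  generalize pioSize (fun n => (numPartitions (valueSet g) n : ℤ)) n = s at hs hsize hC ⊢
  have hs1 : s ≤ s ^ ((D + 1) * e + 1) := le_self_pow₀ hs (by omega)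
  have hs2 : s ^ ((D + 1) * e) ≤ s ^ ((D + 1) * e + 1) := pow_le_pow_right₀ hs (by omega)
  have hs0 : 0 ≤ s ^ ((D + 1) * e + 1) := by positivity
  push_cast
  rw [add_mul]
  by_cases h : d ∣ n
  · obtain ⟨t, ht, hc⟩ := (does_partitionMachine_of_dvd hd0 h (hcount n)).computes
    refine ⟨t, hc, ?_⟩
    have h1 : (t : ℝ) ≤ 20 * ((n : ℕ).size : ℝ) + c * (1 + (n : ℕ)) ^ e + 20 := by
      have h2 : t ≤ 20 * (n : ℕ).size + c * (1 + (n : ℕ)) ^ e + 20 := by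
        have := hT n
        omega
      exact_mod_cast h2
    have h2 : (1 + ((n : ℕ) : ℝ)) ^ e ≤ (C * s ^ (D + 1)) ^ e := by
      gcongr
      exact hC h
    rw [mul_pow, ← pow_mul] at h2
    have h3 : (c : ℝ) * (1 + ((n : ℕ) : ℝ)) ^ e ≤ c * C ^ e * s ^ ((D + 1) * e + 1) := by
      rw [mul_assoc]
      refine mul_le_mul_of_nonneg_left (h2.trans ?_) (Nat.cast_nonneg _)
      gcongr
    linarith
  · have h0 := numPartitions_eq_zero hd h
    rw [h0]
    obtain ⟨t, ht, hc⟩ := (does_partitionMachine_of_not_dvd M hd0 h).computes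
    refine ⟨t, hc, ?_⟩
    have h1 : (t : ℝ) ≤ 23 * ((n : ℕ).size : ℝ) + 20 := by exact_mod_cast ht
    have h2 : 0 ≤ (c : ℝ) * C ^ e * s ^ ((D + 1) * e + 1) := by positivity
    linarith

/-! ### Squares -/

/-- A machine for the squares: add the number to itself. -/
def squareMachine : TM :=
  (drain .io).seq <| (undrainTwo .t .x .g).seq <| toUnary.seq <|
  (TM.loop Reg.a.idx 0 (adder.seq (Prog.pop .a).tm)).seq <|
  (clear .x).seq <| (drain .y).seq (undrain .t .io)

theorem does_squareMachine (n : ℕ) :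
    Does squareMachine { io := binaryNat n } { io := binaryNat (n ^ 2) }
      (n * (60 * (n + n ^ 2) + 70) + n * (25 * n + 80) + 17 * n ^ 2 + 50) := by
  have size_le : ∀ k : ℕ, k.size ≤ k := fun k => Nat.size_le.2 Nat.lt_two_pow_self
  have e1 := does_drain (r := .io) (by decide) (s := { io := binaryNat n }) (m := n) rfl rfl
  have e2 := does_undrainTwo (q := .t) (r := .x) (r' := .g) (by decide) (by decide) (by decide)
    (s := { t := lowDigits n n.size }) rfl rfl rfl
  rw [mod_two_pow_size] at e2
  have e3 := does_toUnary (s := { x := binaryNat n, g := binaryNat n }) rfl rfl rfl rfl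
  have e4 : Does (TM.loop Reg.a.idx 0 (adder.seq (Prog.pop .a).tm))
      { x := binaryNat n, a := unary n } { x := binaryNat n, y := binaryNat (n ^ 2) }
      (n * (60 * (n + n ^ 2) + 60 + 1 + 1 + 2) + 1) := by
    -- The unary copy of `n` counts `n` additions of `n`; time polynomial in `n` itself is enough
    -- here.
    refine does_loop (fun j => { x := binaryNat n, y := binaryNat (n * j), a := unary (n - j) })
      n ?_ ?_ rfl ?_ ?_
    · simp [binaryNat_zero]
    · simp [unary, sq]
    · intro j hj
      simp [Regs.get, headI_unary]
      omega
    · intro j hj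
      have h := does_adder (x := n) (y := n * j) (c := 0)
        (s := { x := binaryNat n, y := binaryNat (n * j), a := unary (n - j) }) rfl rfl rfl
        (by omega) rfl rfl
      have h' := (Prog.pop .a).does
        { x := binaryNat n, y := binaryNat (n + n * j), a := unary (n - j) }
      refine ((h.mono (t' := 60 * (n + n ^ 2) + 60) ?_).seq h').congr_right ?_
      · have h1 := size_le n
        have h2 := size_le (n * j)
        have h3 : n * j ≤ n ^ 2 := by rw [sq]; exact Nat.mul_le_mul_left n hj.le
        omega
      · simp [Prog.exec, Regs.set, Regs.get, tail_unary, Nat.sub_sub, mul_add, add_comm]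
  have e5 := does_clear_binaryNat (r := .x)
    (s := { x := binaryNat n, y := binaryNat (n ^ 2) }) rfl
  have e6 := does_drain (r := .y) (by decide) (s := { y := binaryNat (n ^ 2) }) (m := n ^ 2)
    rfl rfl
  have e7 := does_undrain (q := .t) (r := .io) (by decide)
    (s := { t := lowDigits (n ^ 2) (n ^ 2).size }) rfl rfl
  rw [mod_two_pow_size] at e7
  refine (e1.seq (e2.seq (e3.seq (e4.seq (e5.seq (e6.seq e7)))))).mono ?_
  have h1 := size_le n
  have h2 := size_le (n ^ 2)
  have h3 : n.size * (25 * n + 30) ≤ n * (25 * n + 30) := Nat.mul_le_mul_right _ h1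
  ring_nf at h3 ⊢
  omega

theorem computesInPolySteps_squareMachine :
    ComputesInPolySteps squareMachine fun n => n ^ 2 := by
  have h : PolyBounded fun n =>
      n * (60 * (n + n ^ 2) + 70) + n * (25 * n + 80) + 17 * n ^ 2 + 50 := by
    have h1 := PolyBounded.id
    have hk := PolyBounded.const
    repeat' first | exact h1 | exact hk _ | apply PolyBounded.add | apply PolyBounded.mul
  obtain ⟨c, e, h⟩ := h
  refine ⟨c, e, fun n => ?_⟩
  obtain ⟨t, ht, hc⟩ := (does_squareMachine n).computes
  exact ⟨t, by simpa using hc, ht.trans (h n)⟩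

/-! ### Assembling the statement -/

theorem exists_isGcdOf (A : Set ℕ) : ∃ d, IsGcdOf d A :=
  ⟨Nat.setGcd A, fun _ => Nat.dvd_setGcd_iff⟩

theorem isPIO_numPartitions {g : ℕ+ → ℕ+} (hg : StrictMono g)
    (hM : ∃ M : TM, ComputesInPolySteps M g)
    (hD : ∃ D : ℕ, ∀ n : ℕ+, (g n : ℕ) < (1 + (n : ℕ)) ^ D) :
    IsPIO fun n => (numPartitions (valueSet g) n : ℤ) :=
  let ⟨_, hM⟩ := hM
  let ⟨_, hD⟩ := hD
  let ⟨_, hd⟩ := exists_isGcdOf (valueSet g)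
  ⟨_, isPIOAlgorithm_partitionMachine hg hD hM hd⟩

theorem mainTheorem6 :
    (∀ g : ℕ+ → ℕ+, StrictMono g → (∃ M : TM, ComputesInPolySteps M g) →
      (∃ D : ℕ, ∀ n : ℕ+, (g n : ℕ) < (1 + (n : ℕ)) ^ D) →
        HasProd (fun i : ℕ+ => (1 + ∑' j : ℕ+, PowerSeries.X ^ ((g i : ℕ) * (j : ℕ)) : ℚ⟦X⟧))
          (PowerSeries.mk fun n => (numPartitions (valueSet g) n : ℚ)) ∧
        HasProd (fun i : ℕ+ => ((1 - PowerSeries.X ^ (g i : ℕ))⁻¹ : ℚ⟦X⟧))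
          (PowerSeries.mk fun n => (numPartitions (valueSet g) n : ℚ)) ∧
        IsPIO (fun n => (numPartitions (valueSet g) n : ℤ))) ∧
    (∃ construct : TM × ℕ × List ℕ → TM, Computable construct ∧
      ∀ g : ℕ+ → ℕ+, StrictMono g →
        (∃ D : ℕ, ∀ n : ℕ+, (g n : ℕ) < (1 + (n : ℕ)) ^ D) →
        ∀ M : TM, ComputesInPolySteps M g →
        ∀ d : ℕ, IsGcdOf d (valueSet g) →
        ∀ B : List ℕ, (∀ b ∈ B, b ∈ valueSet g) → IsGcdOf d {b | b ∈ B} →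
          IsPIOAlgorithm (construct (M, d, B)) (fun n => (numPartitions (valueSet g) n : ℤ))) ∧
    IsPIO (fun n => (numPartitions {s : ℕ | ∃ k : ℕ+, s = (k : ℕ) ^ 2} n : ℤ)) := by
  refine ⟨fun g hg hM hD => ⟨?_, hasProd_numPartitions hg.injective,
    isPIO_numPartitions hg hM hD⟩, ⟨fun p => partitionMachine p.1 p.2.1,
    primrec_partitionMachine.to_comp, fun g hg ⟨_, hD⟩ M hM d hd _ _ _ =>
      isPIOAlgorithm_partitionMachine hg hD hM hd⟩, ?_⟩
  · simp_rw [one_add_tsum_X_pow_mul (PNat.ne_zero _), tsum_X_pow_mul (PNat.ne_zero _)]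
    exact hasProd_numPartitions hg.injective
  · have hg : StrictMono fun n : ℕ+ => n ^ 2 := fun a b h => by
      rw [← PNat.coe_lt_coe, PNat.pow_coe, PNat.pow_coe]
      exact Nat.pow_lt_pow_left h two_ne_zero
    have h := isPIO_numPartitions hg ⟨_, computesInPolySteps_squareMachine⟩
      ⟨2, fun n => by
        rw [PNat.pow_coe]
        exact Nat.pow_lt_pow_left (by omega) two_ne_zero⟩
    have hA : valueSet (fun n : ℕ+ => n ^ 2) = {s : ℕ | ∃ k : ℕ+, s = (k : ℕ) ^ 2} := by
      ext s
      simp [valueSet, eq_comm]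
    rwa [hA] at h
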